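/- **Setting.** Let $(X_i,Y_i,\tilde Y_i,Z_i,M_i)$, $i=1,\dots,n+1$, be random points with covariates $X_i\in\mathcal X$, clean labels $Y_i\in\mathbb R$, observed labels $\tilde Y_i\in\mathbb R$ (a missing label being coded by a real number), privileged information $Z_i\in\mathcal Z$ and corruption indicators $M_i\in\{0,1\}$, where $\tilde Y_i=Y_i$ whenever $M_i=0$. The point $n+1$ is the test point, written $(X^{\rm test},Y^{\rm test},Z^{\rm test},M^{\rm test})$. Let $0<\beta<\alpha<1$. Let $\mathcal I_1,\mathcal I_2,\mathcal J_2\subseteq\{1,\dots,n\}$ with $\mathcal I_1$ disjoint from $\mathcal I_2$ and from $\mathcal J_2$ ($\mathcal J_2=\mathcal I_2$ is allowed). The models $\hat f$ and $\hat g$ are (measurably) fitted on the observed data $(X_i,\tilde Y_i,Z_i,M_i)_{i\in\mathcal I_1}$, $\mathcal S(x,y;\hat f)\in\mathbb R$ is a score function, $S_i=\mathcal S(X_i,\tilde Y_i;\hat f)$, and $\mathcal I_2^{\rm uc}=\{i\in\mathcal I_2: M_i=0\}$. Write $\mathrm{Quantile}(p;\nu)=\inf\{q\in[-\infty,\infty]:\nu([-\infty,q])\ge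 p\}$, with $\inf\emptyset=\infty$. All prediction sets have the form $C(x)=\{y\in\mathbb R:\mathcal S(x,y;\hat f)\le Q\}$, with the following thresholds. * Naive CP: $Q^{\rm CP}$ is the $(1+1/|\mathcal I_2^{\rm uc}|)(1-\alpha)$-th empirical quantile of $\{S_i\}_{i\in\mathcal I_2^{\rm uc}}$ ($\infty$ if $\mathcal I_2^{\rm uc}=\emptyset$ or if the level exceeds $1$). * PCP, with real random weights $w_i$: $Q_i=\mathrm{Quantile}\big(1-\alpha+\beta;\ \sum_{j\in\mathcal I_2^{\rm uc}}p^i_j\delta_{S_j}+p^i_\infty\delta_\infty\big)$ for $i\in\mathcal I_2$, where $p^i_j=w_j/(\sum_{k\in\mathcal I_2^{\rm uc}}w_k+w_i)$ and $p^i_\infty=w_i/(\sum_{k\in\mathcal I_2^{\rm uc}}w_k+w_i)$; and $Q^{\rm PCP}=\mathrm{Quantile}\big(1-\beta;\ \frac1{|\mathcal I_2|+1}(\sum_{i\in\mathcal I_2}\delta_{Q_i}+\delta_\infty)\big)$. * UI, with real random imputation errors $e_i$ (for instance drawn uniformly from the residuals of clean reference points with privileged information $Z_i$): $\bar Y_i=\tilde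 Y_i$ if $M_i=0$, $\bar Y_i=\hat g(X_i,Z_i)+e_i$ if $M_i=1$, $\bar S_i=\mathcal S(X_i,\bar Y_i;\hat f)$, and $Q^{\rm UI}=\mathrm{Quantile}\big(1-\alpha;\ \frac1{|\mathcal J_2|+1}(\sum_{i\in\mathcal J_2}\delta_{\bar S_i}+\delta_\infty)\big)$. Let $C^{\rm TriplyRobust}(x)=C^{\rm Naive\,CP}(x)\cup C^{\rm PCP}(x)\cup C^{\rm UI}(x)$. **Theorem.** Suppose that the $n+1$ points are exchangeable and that $(X^{\rm test},Y^{\rm test})\perp M^{\rm test}\mid Z^{\rm test}$. Suppose further that at least one of the following holds. 1. The scores $\{S_i: i\in\mathcal I_2^{\rm uc}\}\cup\{\mathcal S(X^{\rm test},Y^{\rm test};\hat f)\}$ are exchangeable, i.e. for every $A\subseteq\mathcal I_2$ with $\mathbb P(\mathcal I_2^{\rm uc}=A)>0$, the scores $S_i$, $i\in A$, together with the test score are exchangeable conditionally on $\mathcal I_2^{\rm uc}=A$. 2. (PCP) For every $i$, given $Z_i$, the indicator $M_i$ is independent of $(X_i,Y_i)$ jointly with all the other points $(X_j,Y_j,\tilde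 Y_j,Z_j,M_j)$, $j\ne i$; $P_Z$ is absolutely continuous with respect to $P_{Z\mid M=0}$; and the weights are the true ones, $w_i=\mathbb P(M_i=0)/\mathbb P(M_i=0\mid Z_i)$ almost surely for $i\in\mathcal I_2$. 3. (UI) The $n+1$ points are i.i.d.; conditionally on all the points, the errors $e_i$, $i\in\mathcal J_2$, are independent, $e_i$ being drawn from the true conditional distribution of $Y-\hat g(X,Z)$ given $Z=Z_i$ (with $\hat g$ held fixed); and there is a measurable function $g^*$ such that $\varepsilon=Y-g^*(X,Z)$ satisfies $\varepsilon\perp X\mid Z$; $C^{\rm UI}(x)=[a(x),b(x)]\cap\mathbb R$ for all $x$, with $a(x),b(x)\in[-\infty,\infty]$ ($a(X^{\rm test})$ and $b(X^{\rm test})$ being measurable); the residual $R^{\rm test}=\hat g(X^{\rm test},Z^{\rm test})-g^*(X^{\rm test},Z^{\rm test})$ satisfies $R^{\rm test}\perp\big(g^*(X^{\rm test},Z^{\rm test}),a(X^{\rm test}),b(X^{\rm test})\big)\mid Z^{\rm test}$ (with the fitted models held fixed, i.e. also conditionally on the data in $\mathcal I_1$); and $Y^{\rm test}$ has a conditional density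 $f_{x,z}$ given $X^{\rm test}=x,Z^{\rm test}=z$ such that almost surely, for $P_{X,Z}$-almost every $(x,z)$ and all $v>0$, $f_{x,z}(b(x)+v)\le f_{x,z}(b(x)-v)$ if $b(x)$ is finite, and $f_{x,z}(a(x)-v)\le f_{x,z}(a(x)+v)$ if $a(x)$ is finite. Then $$\mathbb P\big(Y^{\rm test}\in C^{\rm TriplyRobust}(X^{\rm test})\big)\ge 1-\alpha .$$ -/

import Mathlib

open MeasureTheory ProbabilityTheory

noncomputable section

namespace TriplyRobust

/-- A family of random variables is exchangeable under `ν`: its joint law is invariant under every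
permutation of the index set. -/
def Exchangeable {Ω ι β : Type*} [MeasurableSpace Ω] [MeasurableSpace β] (ν : Measure Ω)
    (ξ : ι → Ω → β) : Prop :=
  ∀ σ : Equiv.Perm ι, IdentDistrib (fun ω i => ξ (σ i) ω) (fun ω i => ξ i ω) ν ν

/-! ### Quantiles and thresholds (deterministic) -/

/-- `Quantile(p; ν)`, the smallest `q` with `ν (-∞, q] ≥ p`. It is `∞` if there is no such `q`. -/
def quantile (p : ℝ) (ν : Measure EReal) : EReal :=
  sInf {q : EReal | p ≤ ν.real (Set.Iic q)}

/-- The unweighted conformal threshold: the `(1 + 1/|A|)(1 - α)`-th empirical quantile of the scores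
`s i`, `i ∈ A` (it is `∞` if that level exceeds `1` or if `A` is empty). -/
def cpThreshold {n : ℕ} (α : ℝ) (A : Finset (Fin n)) (s : Fin n → ℝ) : EReal :=
  quantile ((1 + 1 / (A.card : ℝ)) * (1 - α))
    (∑ i ∈ A, ENNReal.ofReal (1 / (A.card : ℝ)) • Measure.dirac (s i : EReal))

/-- The weighted conformal threshold at level `τ`, from the scores `s j` and weights `w j`, `j ∈ A`,
for a point of weight `w₀`: the `τ`-quantile of `∑ j ∈ A, p j δ_{s j} + p₀ δ_∞`,
where `p j = w j / (∑ k ∈ A, w k + w₀)` and `p₀ = w₀ / (∑ k ∈ A, w k + w₀)`. -/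
def wcpThreshold {n : ℕ} (τ : ℝ) (A : Finset (Fin n)) (s w : Fin n → ℝ) (w₀ : ℝ) : EReal :=
  quantile τ
    ((∑ j ∈ A, ENNReal.ofReal (w j / (∑ k ∈ A, w k + w₀)) • Measure.dirac (s j : EReal))
      + ENNReal.ofReal (w₀ / (∑ k ∈ A, w k + w₀)) • Measure.dirac (⊤ : EReal))

/-- The `p`-quantile of `∑ i ∈ I, 1/(|I|+1) δ_{q i} + 1/(|I|+1) δ_∞`. -/
def augmentedQuantile {n : ℕ} (p : ℝ) (I : Finset (Fin n)) (q : Fin n → EReal) : EReal :=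
  quantile p
    ((∑ i ∈ I, ENNReal.ofReal (1 / ((I.card : ℝ) + 1)) • Measure.dirac (q i))
      + ENNReal.ofReal (1 / ((I.card : ℝ) + 1)) • Measure.dirac (⊤ : EReal))

/-- The threshold of privileged conformal prediction: each calibration index `i ∈ I` gets the
weighted threshold `Q(Z_i)` at level `1 - α + β` computed from the clean indices `A`, and then the
augmented `(1 - β)`-quantile of these is taken. -/
def pcpThreshold {n : ℕ} (α β : ℝ) (I A : Finset (Fin n)) (s w : Fin n → ℝ) : EReal :=
  augmentedQuantile (1 - β) I (fun i => wcpThreshold (1 - α + β) A s w (w i))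

/-- The density `f` is peaked inside the interval with endpoints `a`, `b`. An infinite endpoint
imposes no condition. -/
def PeakedInside (f : ℝ → ENNReal) (a b : EReal) : Prop :=
  (∀ r : ℝ, b = (r : EReal) → ∀ v : ℝ, 0 < v → f (r + v) ≤ f (r - v)) ∧
  (∀ r : ℝ, a = (r : EReal) → ∀ v : ℝ, 0 < v → f (r - v) ≤ f (r + v))

/-! ### The corrupted data, the fitted models, and the three prediction sets -/

/-- Everything the three procedures use. The sample points are indexed by `Fin (n + 1)`: the indices
`i.castSucc` are the `n` training points, `Fin.last n` is the test point. -/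
structure Experiment (Ω 𝒳 𝒵 𝓕 : Type*) [MeasurableSpace Ω] [MeasurableSpace 𝒳]
    [MeasurableSpace 𝒵] (n : ℕ) where
  /-- covariates -/
  X : Fin (n + 1) → Ω → 𝒳
  /-- clean labels -/
  Y : Fin (n + 1) → Ω → ℝ
  /-- observed, possibly corrupted, labels (a missing label is coded by any real number) -/
  Yobs : Fin (n + 1) → Ω → ℝ
  /-- privileged information -/
  Z : Fin (n + 1) → Ω → 𝒵
  /-- corruption indicators, `0` for clean -/
  M : Fin (n + 1) → Ω → Fin 2
  measurable_X : ∀ i, Measurable (X i)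
  measurable_Y : ∀ i, Measurable (Y i)
  measurable_Yobs : ∀ i, Measurable (Yobs i)
  measurable_Z : ∀ i, Measurable (Z i)
  measurable_M : ∀ i, Measurable (M i)
  Yobs_eq_of_clean : ∀ i ω, M i ω = 0 → Yobs i ω = Y i ω
  /-- indices used to fit the models -/
  I₁ : Finset (Fin n)
  /-- calibration indices of naive CP and of PCP -/
  I₂ : Finset (Fin n)
  /-- calibration indices of UI (equal to `I₂`, or smaller if a reference set is split off) -/
  J₂ : Finset (Fin n)
  disjoint_I₁_I₂ : Disjoint I₁ I₂
  disjoint_I₁_J₂ : Disjoint I₁ J₂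
  /-- the model `f̂`, fitted on the observed data in `I₁` -/
  fhat : (I₁ → 𝒳 × ℝ × 𝒵 × Fin 2) → 𝓕
  /-- the model `ĝ`, fitted on the observed data in `I₁` -/
  ghat : (I₁ → 𝒳 × ℝ × 𝒵 × Fin 2) → 𝒳 → 𝒵 → ℝ
  /-- the non-conformity score `𝒮(x, y; f)` -/
  score : 𝒳 → ℝ → 𝓕 → ℝ
  measurable_score :
    Measurable fun p : (I₁ → 𝒳 × ℝ × 𝒵 × Fin 2) × 𝒳 × ℝ => score p.2.1 p.2.2 (fhat p.1)
  measurable_ghat :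
    Measurable fun p : (I₁ → 𝒳 × ℝ × 𝒵 × Fin 2) × 𝒳 × 𝒵 => ghat p.1 p.2.1 p.2.2
  /-- the weights handed to PCP (true, estimated, or any others) -/
  w : Fin n → Ω → ℝ
  measurable_w : ∀ i, Measurable (w i)
  /-- the errors that UI draws for the imputation (from a set of reference residuals, from the true
  error distribution, or in any other way) -/
  e : Fin n → Ω → ℝ
  measurable_e : ∀ i, Measurable (e i)

namespace Experiment

variable {Ω 𝒳 𝒵 𝓕 : Type*} [MeasurableSpace Ω] [MeasurableSpace 𝒳] [MeasurableSpace 𝒵] {n : ℕ}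

/-- The full sample points `(X_i, Y_i, Ỹ_i, Z_i, M_i)`. -/
def sample (D : Experiment Ω 𝒳 𝒵 𝓕 n) (i : Fin (n + 1)) (ω : Ω) : 𝒳 × ℝ × ℝ × 𝒵 × Fin 2 :=
  (D.X i ω, D.Y i ω, D.Yobs i ω, D.Z i ω, D.M i ω)

/-- The observed data `(X_i, Ỹ_i, Z_i, M_i)`, `i ∈ I₁`, on which the models are fitted. -/
def trainData (D : Experiment Ω 𝒳 𝒵 𝓕 n) (ω : Ω) : D.I₁ → 𝒳 × ℝ × 𝒵 × Fin 2 :=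
  fun i => (D.X i.1.castSucc ω, D.Yobs i.1.castSucc ω, D.Z i.1.castSucc ω, D.M i.1.castSucc ω)

/-- `S_i = 𝒮(X_i, Ỹ_i; f̂)`. -/
def calScore (D : Experiment Ω 𝒳 𝒵 𝓕 n) (i : Fin n) (ω : Ω) : ℝ :=
  D.score (D.X i.castSucc ω) (D.Yobs i.castSucc ω) (D.fhat (D.trainData ω))

/-- `𝒮(X^test, Y^test; f̂)`. -/
def testScore (D : Experiment Ω 𝒳 𝒵 𝓕 n) (ω : Ω) : ℝ :=
  D.score (D.X (Fin.last n) ω) (D.Y (Fin.last n) ω) (D.fhat (D.trainData ω))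

/-- The clean calibration indices, `{i ∈ I₂ : M_i = 0}`. -/
def cleanCal (D : Experiment Ω 𝒳 𝒵 𝓕 n) (ω : Ω) : Finset (Fin n) :=
  D.I₂.filter (fun i => D.M i.castSucc ω = 0)

/-- The imputed label `Ȳ_i`: the observed (hence clean) label if `M_i = 0`, and
`ĝ(X_i, Z_i) + e_i` otherwise. -/
def imputedLabel (D : Experiment Ω 𝒳 𝒵 𝓕 n) (i : Fin n) (ω : Ω) : ℝ :=
  if D.M i.castSucc ω = 0 then D.Yobs i.castSucc ω
  else D.ghat (D.trainData ω) (D.X i.castSucc ω) (D.Z i.castSucc ω) + D.e i ω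

/-- `S̄_i = 𝒮(X_i, Ȳ_i; f̂)`. -/
def imputedScore (D : Experiment Ω 𝒳 𝒵 𝓕 n) (i : Fin n) (ω : Ω) : ℝ :=
  D.score (D.X i.castSucc ω) (D.imputedLabel i ω) (D.fhat (D.trainData ω))

/-- `{y : 𝒮(x, y; f̂) ≤ q}`. -/
def sublevel (D : Experiment Ω 𝒳 𝒵 𝓕 n) (q : EReal) (ω : Ω) (x : 𝒳) : Set ℝ :=
  {y | (D.score x y (D.fhat (D.trainData ω)) : EReal) ≤ q}

/-- The prediction set of naive CP: conformal prediction on the clean calibration points only. -/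
def naiveSet (D : Experiment Ω 𝒳 𝒵 𝓕 n) (α : ℝ) (ω : Ω) (x : 𝒳) : Set ℝ :=
  D.sublevel (cpThreshold α (D.cleanCal ω) (fun i => D.calScore i ω)) ω x

/-- The prediction set of privileged conformal prediction. -/
def pcpSet (D : Experiment Ω 𝒳 𝒵 𝓕 n) (α β : ℝ) (ω : Ω) (x : 𝒳) : Set ℝ :=
  D.sublevel (pcpThreshold α β D.I₂ (D.cleanCal ω) (fun i => D.calScore i ω) (fun i => D.w i ω)) ω x

/-- The prediction set of uncertain imputation. -/
def uiSet (D : Experiment Ω 𝒳 𝒵 𝓕 n) (α : ℝ) (ω : Ω) (x : 𝒳) : Set ℝ :=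
  D.sublevel (augmentedQuantile (1 - α) D.J₂ (fun i => (D.imputedScore i ω : EReal))) ω x

/-- The triply robust prediction set. -/
def triplySet (D : Experiment Ω 𝒳 𝒵 𝓕 n) (α β : ℝ) (ω : Ω) (x : 𝒳) : Set ℝ :=
  D.naiveSet α ω x ∪ D.pcpSet α β ω x ∪ D.uiSet α ω x

/-! ### The assumptions -/

/-- `(X, Y) ⊥ M | Z` for a single sample point (the test point). -/
def CondIndepGivenPI [StandardBorelSpace Ω] (D : Experiment Ω 𝒳 𝒵 𝓕 n) (μ : Measure Ω)
    [IsFiniteMeasure μ] : Prop :=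
  CondIndepFun (MeasurableSpace.comap (D.Z (Fin.last n)) inferInstance)
    (D.measurable_Z (Fin.last n)).comap_le
    (fun ω => (D.X (Fin.last n) ω, D.Y (Fin.last n) ω)) (D.M (Fin.last n)) μ

/-- The scores of the clean calibration points together with the test score are exchangeable: for
every index set `A`, given that `A` is the set of clean calibration indices, the family consisting
of the test score (index `none`) and of the scores `S_i`, `i ∈ A`, is exchangeable. -/
def ScoresExchangeable (D : Experiment Ω 𝒳 𝒵 𝓕 n) (μ : Measure Ω) : Prop :=
  ∀ A : Finset (Fin n),
    Exchangeable (μ[|{ω | D.cleanCal ω = A}])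
      (fun (o : Option A) ω => o.elim (D.testScore ω) (fun i => D.calScore i.1 ω))

/-- The true weight `P(M = 0) / P(M = 0 | Z = Z_i)`. -/
def trueWeight (D : Experiment Ω 𝒳 𝒵 𝓕 n) (μ : Measure Ω) (i : Fin (n + 1)) (ω : Ω) : ℝ :=
  μ.real {ω | D.M i ω = 0} /
    (μ⟦{ω | D.M i ω = 0} | MeasurableSpace.comap (D.Z i) inferInstance⟧) ω

/-- The assumptions for the validity of PCP. -/
structure PCPAssumptions [StandardBorelSpace Ω] (D : Experiment Ω 𝒳 𝒵 𝓕 n) (μ : Measure Ω)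
    [IsFiniteMeasure μ] : Prop where
  /-- the points `(X_i, Y_i, Ỹ_i, Z_i, M_i)` are exchangeable -/
  exchangeable : Exchangeable μ D.sample
  /-- the privileged information explains the corruptions: given `Z_i`, the indicator `M_i` is
  independent of `(X_i, Y_i)` and of the other sample points (for i.i.d. points this is the same as
  `(X, Y) ⊥ M | Z`) -/
  condIndep : ∀ i : Fin (n + 1),
    CondIndepFun (MeasurableSpace.comap (D.Z i) inferInstance) (D.measurable_Z i).comap_le
      (fun ω => ((D.X i ω, D.Y i ω), fun j : {j : Fin (n + 1) // j ≠ i} => D.sample j.1 ω))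
      (D.M i) μ
  /-- `P_Z` is absolutely continuous with respect to `P_{Z | M = 0}` -/
  absolutelyContinuous :
    μ.map (D.Z (Fin.last n)) ≪
      (μ[|{ω | D.M (Fin.last n) ω = 0}]).map (D.Z (Fin.last n))
  /-- the weights used are the true ones -/
  weights : ∀ i ∈ D.I₂, ∀ᵐ ω ∂μ, D.w i ω = D.trueWeight μ i.castSucc ω

/-- The true conditional distribution of the error `E = Y - ĝ(X, Z)` given `Z = z`, for the model
`ĝ` fitted on the data `d`. -/
def errorLaw (D : Experiment Ω 𝒳 𝒵 𝓕 n) (μ : Measure Ω) [IsFiniteMeasure μ] :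
    Kernel ((D.I₁ → 𝒳 × ℝ × 𝒵 × Fin 2) × 𝒵) ℝ :=
  condDistrib
    (fun ω => D.Y (Fin.last n) ω
      - D.ghat (D.trainData ω) (D.X (Fin.last n) ω) (D.Z (Fin.last n) ω))
    (fun ω => (D.trainData ω, D.Z (Fin.last n) ω)) μ

lemma measurable_trainData (D : Experiment Ω 𝒳 𝒵 𝓕 n) : Measurable D.trainData :=
  measurable_pi_lambda _ fun i =>
    (D.measurable_X i.1.castSucc).prodMk ((D.measurable_Yobs i.1.castSucc).prodMk
      ((D.measurable_Z i.1.castSucc).prodMk (D.measurable_M i.1.castSucc)))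

/-- The assumptions for the validity of UI, with the conditional model `Y = g*(X, Z) + ε`, endpoint
functions `a`, `b` of the prediction interval, and densities `f (x, z)` of `Y` given
`(X, Z) = (x, z)`. The fitted models are held fixed by conditioning on the data in `I₁`. -/
structure UIAssumptionsWith [StandardBorelSpace Ω] (D : Experiment Ω 𝒳 𝒵 𝓕 n) (μ : Measure Ω)
    [IsFiniteMeasure μ] (α : ℝ) (gstar : 𝒳 → 𝒵 → ℝ) (a b : Ω → 𝒳 → EReal)
    (f : 𝒳 × 𝒵 → ℝ → ENNReal) : Prop where
  /-- the sample points are i.i.d. -/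
  indep : iIndepFun D.sample μ
  identDistrib : ∀ i j, IdentDistrib (D.sample i) (D.sample j) μ μ
  /-- `(X, Y) ⊥ M | Z` -/
  condIndep : D.CondIndepGivenPI μ
  /-- the imputation errors are drawn from the true distribution of `E | Z`: given all the sample
  points, the `e_i` are independent, and `e_i` has the law of `E` given `Z = Z_i` -/
  errors : ∀ᵐ ω ∂μ,
    condDistrib (fun ω (i : D.J₂) => D.e i.1 ω) (fun ω i => D.sample i ω) μ
        (fun i => D.sample i ω)
      = Measure.pi (fun i : D.J₂ => D.errorLaw μ (D.trainData ω, D.Z i.1.castSucc ω))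
  measurable_gstar : Measurable (Function.uncurry gstar)
  /-- the noise `ε = Y - g*(X, Z)` satisfies `ε ⊥ X | Z` -/
  noise :
    CondIndepFun (MeasurableSpace.comap (D.Z (Fin.last n)) inferInstance)
      (D.measurable_Z (Fin.last n)).comap_le
      (fun ω => D.Y (Fin.last n) ω - gstar (D.X (Fin.last n) ω) (D.Z (Fin.last n) ω))
      (D.X (Fin.last n)) μ
  /-- `C^UI(x) = [a(x), b(x)]`, with possibly infinite endpoints -/
  interval : ∀ᵐ ω ∂μ, ∀ x, D.uiSet α ω x = {y : ℝ | a ω x ≤ (y : EReal) ∧ (y : EReal) ≤ b ω x}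
  measurable_a : Measurable fun ω => a ω (D.X (Fin.last n) ω)
  measurable_b : Measurable fun ω => b ω (D.X (Fin.last n) ω)
  /-- the residual `R^test = ĝ(X^test, Z^test) - g*(X^test, Z^test)` is independent of
  `(g*(X^test, Z^test), C^UI(X^test))` given `Z^test` -/
  residual :
    CondIndepFun
      (MeasurableSpace.comap (fun ω => (D.Z (Fin.last n) ω, D.trainData ω)) inferInstance)
      ((D.measurable_Z (Fin.last n)).prodMk D.measurable_trainData).comap_le
      (fun ω => D.ghat (D.trainData ω) (D.X (Fin.last n) ω) (D.Z (Fin.last n) ω)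
        - gstar (D.X (Fin.last n) ω) (D.Z (Fin.last n) ω))
      (fun ω => (gstar (D.X (Fin.last n) ω) (D.Z (Fin.last n) ω),
        a ω (D.X (Fin.last n) ω), b ω (D.X (Fin.last n) ω))) μ
  /-- `f (x, z)` is the density of `Y^test` given `(X^test, Z^test) = (x, z)` -/
  measurable_density : ∀ p, Measurable (f p)
  density :
    ∀ᵐ p ∂(μ.map fun ω => (D.X (Fin.last n) ω, D.Z (Fin.last n) ω)),
      condDistrib (D.Y (Fin.last n)) (fun ω => (D.X (Fin.last n) ω, D.Z (Fin.last n) ω)) μ p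
        = volume.withDensity (f p)
  /-- the density is peaked inside `[a(x), b(x)]` -/
  peaked : ∀ᵐ ω ∂μ, ∀ᵐ p ∂(μ.map fun ω => (D.X (Fin.last n) ω, D.Z (Fin.last n) ω)),
    PeakedInside (f p) (a ω p.1) (b ω p.1)

/-- The assumptions for the validity of UI. -/
def UIAssumptions [StandardBorelSpace Ω] (D : Experiment Ω 𝒳 𝒵 𝓕 n) (μ : Measure Ω)
    [IsFiniteMeasure μ] (α : ℝ) : Prop :=
  ∃ (gstar : 𝒳 → 𝒵 → ℝ) (a b : Ω → 𝒳 → EReal) (f : 𝒳 × 𝒵 → ℝ → ENNReal),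
    D.UIAssumptionsWith μ α gstar a b f

end Experiment

end TriplyRobust

end

/-! The triply robust set contains each of its three members, so it suffices that each alternative
hypothesis gives its own set coverage `1 - α`. All three arguments rest on one combinatorial fact,
`sum_weight_of_large_le`: among finitely many weighted scores, those that strictly exceed points
carrying a fraction `τ` of the total weight carry at most a fraction `1 - τ` themselves. Averaging
over the transpositions of the test index with the calibration indices turns this into
`lintegral_weight_of_large_le`, and unit weights give `measure_large_le`. These transpositions fix
`I₁`, so randomly fitted models do no harm. Quantile thresholds enter only through the counting
conditions derived from `le_quantile_iff`.

Naive CP: apply the unweighted inequality conditionally on the set of clean calibration indices,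
then sum over the possible sets.

PCP: let `w(z)` be the true weight and `c` the probability of being clean. Since the test indicator
is independent of everything else given `Z`, weighting the sample law by `w(Z)` on the event that
the test point is clean gives `c` times the law of the sample with the test point made clean. The
weighted inequality therefore bounds by `α - β` the chance that the test score exceeds the weighted
threshold built with the test weight (`measure_weightedMiss_le`). PCP does not know that weight. But
the threshold is monotone in the weight, and by exchangeability the test weight exceeds too many
calibration weights with probability at most `β` (`measure_large_weight_le`). A union bound
finishes.

UI: attach to every sample point, the test point included, an error drawn from the true error law.
The imputed scores are then exchangeable, so an imputed test label is covered with probability at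
least `1 - α` (`one_le_imputed_coverage`). On a clean test point the imputed label is the true one.
On a corrupted one write `Y = g* + ε`. The error law is that of `ε - R'` with `ε` and `R'`
independent (`errorLaw_ae_eq`), so the imputed label is distributed as `g* + ε + (R - R')`, where
`R` and `R'` are independent with the same law given `Z` and the training data. The shift `R - R'`
is symmetric, and a symmetric shift cannot increase the mass of an interval inside which the density
is peaked (`PeakedInside.measure_shift_le`). So the true label is covered at least as often as the
imputed one (`lintegral_imputed_le`). -/

noncomputable section

/-! ### Quantile thresholds as counting conditions -/

namespace TriplyRobust

/-- The mass that a finitely supported measure with an atom at `∞` gives to `[-∞, q]`, `q < ∞`. -/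
lemma real_Iic_of_lt_top {ι : Type*} (I : Finset ι) (c : ι → ℝ) (hc : ∀ i ∈ I, 0 ≤ c i)
    (x : ι → EReal) (c₀ : ℝ) {q : EReal} (hq : q < ⊤) :
    ((∑ i ∈ I, ENNReal.ofReal (c i) • Measure.dirac (x i))
      + ENNReal.ofReal c₀ • Measure.dirac (⊤ : EReal)).real (Set.Iic q)
      = ∑ i ∈ I with x i ≤ q, c i := by
  have h1 : ((∑ i ∈ I, ENNReal.ofReal (c i) • Measure.dirac (x i))
      + ENNReal.ofReal c₀ • Measure.dirac (⊤ : EReal)) (Set.Iic q)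
      = ∑ i ∈ I with x i ≤ q, ENNReal.ofReal (c i) := by
    simp [Measure.dirac_apply' _ measurableSet_Iic, Set.indicator_apply, hq.ne, Finset.sum_filter]
  rw [Measure.real, h1, ENNReal.toReal_sum (by simp)]
  refine Finset.sum_congr rfl fun i hi => ENNReal.toReal_ofReal (hc i (Finset.mem_filter.1 hi).1)

/-- A point is at most the `p`-quantile of a finitely supported measure if and only if the mass
strictly below the point is less than `p`. -/
lemma le_quantile_iff {ι : Type*} (I : Finset ι) (c : ι → ℝ) (hc : ∀ i ∈ I, 0 ≤ c i)
    (x : ι → EReal) (c₀ : ℝ) {p : ℝ} (hp : 0 < p) (s : EReal) :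
    s ≤ quantile p ((∑ i ∈ I, ENNReal.ofReal (c i) • Measure.dirac (x i))
      + ENNReal.ofReal c₀ • Measure.dirac (⊤ : EReal)) ↔ ∑ i ∈ I with x i < s, c i < p := by
  constructor
  · intro h
    by_contra! hlt
    have hne : (I.filter fun i => x i < s).Nonempty := by
      rw [Finset.nonempty_iff_ne_empty]
      intro h0
      rw [h0] at hlt
      simp at hlt
      linarith
    -- The largest atom below `s` already has all the mass strictly below `s` at or under it, so the
    -- quantile would be at most `x i₀ < s`.
    obtain ⟨i₀, hi₀, hmax⟩ := Finset.exists_max_image _ x hne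
    have hs : x i₀ < s := (Finset.mem_filter.1 hi₀).2
    refine absurd (h.trans (sInf_le ?_)) (not_le.2 hs)
    change p ≤ _
    rw [real_Iic_of_lt_top I c hc x c₀ (hs.trans_le le_top)]
    refine hlt.trans (Finset.sum_le_sum_of_subset_of_nonneg ?_ ?_)
    · intro i hi
      exact Finset.mem_filter.2 ⟨(Finset.mem_filter.1 hi).1, hmax i hi⟩
    · intro i hi _
      exact hc i (Finset.mem_filter.1 hi).1
  · intro h
    refine le_sInf fun q hq => ?_
    by_contra! hqs
    change p ≤ _ at hq
    rw [real_Iic_of_lt_top I c hc x c₀ (hqs.trans_le le_top)] at hq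
    have : ∑ i ∈ I with x i ≤ q, c i ≤ ∑ i ∈ I with x i < s, c i := by
      refine Finset.sum_le_sum_of_subset_of_nonneg ?_ ?_
      · intro i hi
        rw [Finset.mem_filter] at hi ⊢
        exact ⟨hi.1, hi.2.trans_lt hqs⟩
      · intro i hi _
        exact hc i (Finset.mem_filter.1 hi).1
    linarith

lemma le_augmentedQuantile_iff {n : ℕ} {p : ℝ} (hp : 0 < p) (I : Finset (Fin n))
    (q : Fin n → EReal) (s : EReal) :
    s ≤ augmentedQuantile p I q ↔
      ∑ _i ∈ I with q _i < s, (1 : ℝ) < p * ((I.card : ℝ) + 1) := by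
  rw [augmentedQuantile, le_quantile_iff I _ (fun i _ => by positivity) q _ hp]
  have h0 : (0 : ℝ) < (I.card : ℝ) + 1 := by positivity
  rw [← Finset.sum_div, div_lt_iff₀ h0]

/-- The factor `1 + 1/|A|` turns the empirical quantile into the augmented one with `|A| + 1`
points. For empty `A` the convention `1 / 0 = 0` leaves the level `1 - α` and a zero measure, hence
the threshold `⊤`, as wanted. -/
lemma le_cpThreshold_iff {n : ℕ} {α : ℝ} (hα : α < 1) (A : Finset (Fin n)) (t : Fin n → ℝ)
    (s : ℝ) :
    (s : EReal) ≤ cpThreshold α A t ↔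
      ∑ _i ∈ A with t _i < s, (1 : ℝ) < (1 - α) * ((A.card : ℝ) + 1) := by
  -- The criterion does not involve the mass at `⊤`, so that mass may be taken to be `0`.
  have key := le_quantile_iff A (fun _ => 1 / (A.card : ℝ)) (fun i _ => by positivity)
    (fun i => (t i : EReal)) 0 (p := (1 + 1 / (A.card : ℝ)) * (1 - α))
    (mul_pos (by positivity) (by linarith)) (s : EReal)
  simp only [ENNReal.ofReal_zero, zero_smul, add_zero, EReal.coe_lt_coe_iff] at key
  rw [cpThreshold, key]
  rcases A.eq_empty_or_nonempty with rfl | hA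
  · simp
  · have h0 : (0 : ℝ) < (A.card : ℝ) := by exact_mod_cast hA.card_pos
    rw [← Finset.sum_div, div_lt_iff₀ h0]
    have : (1 + 1 / (A.card : ℝ)) * (1 - α) * A.card = (1 - α) * (A.card + 1) := by
      field_simp
    rw [this]

lemma le_wcpThreshold_iff {n : ℕ} {τ : ℝ} (hτ : 0 < τ) (A : Finset (Fin n)) (t w : Fin n → ℝ)
    (hw : ∀ i ∈ A, 0 ≤ w i) {w₀ : ℝ} (hw₀ : 0 < w₀) (s : EReal) :
    s ≤ wcpThreshold τ A t w w₀ ↔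
      ∑ i ∈ A with (t i : EReal) < s, w i < τ * (∑ i ∈ A, w i + w₀) := by
  have h0 : 0 < ∑ i ∈ A, w i + w₀ := add_pos_of_nonneg_of_pos (Finset.sum_nonneg hw) hw₀
  rw [wcpThreshold, le_quantile_iff A _ (fun i hi => div_nonneg (hw i hi) h0.le) _ _ hτ,
    ← Finset.sum_div, div_lt_iff₀ h0]

/-- The weighted conformal threshold increases with the weight of the point it is meant for. -/
lemma wcpThreshold_mono {n : ℕ} {τ : ℝ} (hτ : 0 < τ) (A : Finset (Fin n)) (t w : Fin n → ℝ)
    (hw : ∀ i ∈ A, 0 ≤ w i) {w₀ w₁ : ℝ} (hw₀ : 0 < w₀) (h : w₀ ≤ w₁) :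
    wcpThreshold τ A t w w₀ ≤ wcpThreshold τ A t w w₁ := by
  rw [le_wcpThreshold_iff hτ A t w hw (hw₀.trans_le h)]
  refine ((le_wcpThreshold_iff hτ A t w hw hw₀ _).1 le_rfl).trans_le ?_
  gcongr

/-! ### The conformal inequality -/

/-- Points whose strictly smaller competitors carry a fraction `τ` of the total weight carry at most
a fraction `1 - τ` of it. -/
lemma sum_weight_of_large_le {ι : Type*} (J : Finset ι) (u t : ι → ℝ) (hu : ∀ j ∈ J, 0 ≤ u j)
    {τ : ℝ} (hτ : τ ≤ 1) :
    ∑ i ∈ J with τ * ∑ j ∈ J, u j ≤ ∑ j ∈ J with t j < t i, u j, u i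
      ≤ (1 - τ) * ∑ j ∈ J, u j := by
  set B := J.filter fun i => τ * ∑ j ∈ J, u j ≤ ∑ j ∈ J with t j < t i, u j with hB
  rcases B.eq_empty_or_nonempty with h0 | hne
  · rw [h0, Finset.sum_empty]
    exact mul_nonneg (by linarith) (Finset.sum_nonneg hu)
  -- Every point strictly below the lowest member of `B` lies outside `B`, and these points already
  -- carry a fraction `τ` of the weight.
  · obtain ⟨i₀, hi₀, hmin⟩ := Finset.exists_min_image B t hne
    have h1 := (Finset.mem_filter.1 hi₀).2
    have h2 : Disjoint B (J.filter fun j => t j < t i₀) := by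
      rw [Finset.disjoint_left]
      intro j hj hj'
      exact absurd (hmin j hj) (not_le.2 (Finset.mem_filter.1 hj').2)
    have h3 : ∑ i ∈ B, u i + ∑ j ∈ J with t j < t i₀, u j ≤ ∑ j ∈ J, u j := by
      classical
      rw [← Finset.sum_union h2]
      refine Finset.sum_le_sum_of_subset_of_nonneg ?_ fun i hi _ => hu i hi
      exact Finset.union_subset (Finset.filter_subset _ _) (Finset.filter_subset _ _)
    linarith

/-- The weighted conformal inequality: if the law of the family is invariant under the
transpositions of `o` with the members of `J`, then on the event that the competitors of `o` with
strictly smaller score carry a fraction `τ` of the total weight, the weight of `o` integrates to at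
most the fraction `1 - τ` of its mean. -/
theorem lintegral_weight_of_large_le {ι S : Type*} [DecidableEq ι] [MeasurableSpace S]
    (P : Measure (ι → S))
    (J : Finset ι) {o : ι} (ho : o ∈ J)
    (hP : ∀ i ∈ J, P.map (fun v => v ∘ Equiv.swap o i) = P)
    (u : S → ℝ) (hu : Measurable u) (hu₀ : ∀ s, 0 ≤ u s)
    (t : (ι → S) → ι → ℝ) (ht : ∀ i, Measurable fun v => t v i)
    (htσ : ∀ i ∈ J, ∀ v j, t (v ∘ Equiv.swap o i) j = t v (Equiv.swap o i j))
    {τ : ℝ} (hτ : τ ≤ 1) :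
    ∫⁻ v in {v | τ * ∑ j ∈ J, u (v j) ≤ ∑ j ∈ J with t v j < t v o, u (v j)},
        ENNReal.ofReal (u (v o)) ∂P
      ≤ ENNReal.ofReal (1 - τ) * ∫⁻ v, ENNReal.ofReal (u (v o)) ∂P := by
  classical
  set B : ι → Set (ι → S) := fun i =>
    {v | τ * ∑ j ∈ J, u (v j) ≤ ∑ j ∈ J with t v j < t v i, u (v j)} with hB
  have hBm : ∀ i, MeasurableSet (B i) := by
    intro i
    simp only [hB, Finset.sum_filter]
    refine measurableSet_le (by fun_prop) ?_
    refine Finset.measurable_sum _ fun j _ => ?_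
    exact Measurable.ite (measurableSet_lt (ht j) (ht i)) (by fun_prop) measurable_const
  have hσm : ∀ i : ι, Measurable fun v : ι → S => v ∘ Equiv.swap o i := fun i =>
    measurable_pi_lambda _ fun j => measurable_pi_apply _
  -- The transposition maps `J` onto itself, so both sums are merely reindexed while the roles of
  -- `o` and `i` are exchanged.
  have hBσ : ∀ i ∈ J, ∀ v : ι → S, v ∘ Equiv.swap o i ∈ B o ↔ v ∈ B i := by
    intro i hi v
    have hJ : ∀ j, j ∈ J ↔ Equiv.swap o i j ∈ J := by
      intro j
      rcases eq_or_ne j o with rfl | h1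
      · simp [ho, hi]
      · rcases eq_or_ne j i with rfl | h2
        · simp [ho, hi]
        · rw [Equiv.swap_apply_of_ne_of_ne h1 h2]
    have e1 : ∑ j ∈ J, u ((v ∘ Equiv.swap o i) j) = ∑ j ∈ J, u (v j) :=
      Finset.sum_equiv (Equiv.swap o i) hJ fun j _ => rfl
    have e2 : ∑ j ∈ J with t (v ∘ Equiv.swap o i) j < t (v ∘ Equiv.swap o i) o,
        u ((v ∘ Equiv.swap o i) j) = ∑ j ∈ J with t v j < t v i, u (v j) := by
      refine Finset.sum_equiv (Equiv.swap o i) (fun j => ?_) fun j _ => rfl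
      rw [Finset.mem_filter, Finset.mem_filter, ← hJ, htσ i hi, htσ i hi, Equiv.swap_apply_left]
    simp only [hB, Set.mem_ofPred_eq, e1, e2]
  have hum : ∀ i, Measurable fun v : ι → S => ENNReal.ofReal (u (v i)) := fun i => by fun_prop
  have hswap : ∀ i ∈ J, ∫⁻ v in B o, ENNReal.ofReal (u (v o)) ∂P
      = ∫⁻ v in B i, ENNReal.ofReal (u (v i)) ∂P := by
    intro i hi
    rw [← lintegral_indicator (hBm o), ← lintegral_indicator (hBm i)]
    conv_lhs => rw [← hP i hi]
    rw [lintegral_map ((hum o).indicator (hBm o)) (hσm i)]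
    refine lintegral_congr fun v => ?_
    simp only [Set.indicator_apply, hBσ i hi v, Function.comp, Equiv.swap_apply_left]
  have hmean : ∀ i ∈ J, ∫⁻ v, ENNReal.ofReal (u (v i)) ∂P = ∫⁻ v, ENNReal.ofReal (u (v o)) ∂P := by
    intro i hi
    conv_rhs => rw [← hP i hi]
    rw [lintegral_map (hum o) (hσm i)]
    refine lintegral_congr fun v => ?_
    simp only [Function.comp, Equiv.swap_apply_left]
  have hcard : (J.card : ENNReal) ≠ 0 := by
    simpa using (Finset.card_pos.2 ⟨o, ho⟩).ne'
  -- By invariance the integrals over all `B i` agree; their sum is bounded pointwise by the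
  -- combinatorial fact. The factor `#J` is cancelled at the end.
  have hsum : (J.card : ENNReal) * ∫⁻ v in B o, ENNReal.ofReal (u (v o)) ∂P
      ≤ (J.card : ENNReal) * (ENNReal.ofReal (1 - τ) * ∫⁻ v, ENNReal.ofReal (u (v o)) ∂P) := by
    calc (J.card : ENNReal) * ∫⁻ v in B o, ENNReal.ofReal (u (v o)) ∂P
        = ∑ i ∈ J, ∫⁻ v, (B i).indicator (fun v => ENNReal.ofReal (u (v i))) v ∂P := by
          rw [← nsmul_eq_mul, ← Finset.sum_const]
          refine Finset.sum_congr rfl fun i hi => ?_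
          rw [hswap i hi, lintegral_indicator (hBm i)]
      _ = ∫⁻ v, ∑ i ∈ J, (B i).indicator (fun v => ENNReal.ofReal (u (v i))) v ∂P :=
          (lintegral_finsetSum _ fun i _ => (hum i).indicator (hBm i)).symm
      _ ≤ ∫⁻ v, ENNReal.ofReal (1 - τ) * ∑ i ∈ J, ENNReal.ofReal (u (v i)) ∂P := by
          refine lintegral_mono fun v => ?_
          have h1 := sum_weight_of_large_le J (fun j => u (v j)) (t v) (fun j _ => hu₀ _) hτ
          have h2 : ∑ i ∈ J, (B i).indicator (fun v => ENNReal.ofReal (u (v i))) v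
              = ENNReal.ofReal (∑ i ∈ J with τ * ∑ j ∈ J, u (v j)
                ≤ ∑ j ∈ J with t v j < t v i, u (v j), u (v i)) := by
            rw [ENNReal.ofReal_sum_of_nonneg fun i _ => hu₀ _, Finset.sum_filter]
            rfl
          change ∑ i ∈ J, (B i).indicator (fun v => ENNReal.ofReal (u (v i))) v ≤ _
          rw [h2, ← ENNReal.ofReal_sum_of_nonneg fun i _ => hu₀ _,
            ← ENNReal.ofReal_mul (by linarith)]
          exact ENNReal.ofReal_le_ofReal h1
      _ = (J.card : ENNReal) * (ENNReal.ofReal (1 - τ) * ∫⁻ v, ENNReal.ofReal (u (v o)) ∂P) := by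
          rw [lintegral_const_mul _ (Finset.measurable_sum _ fun i _ => hum i),
            lintegral_finsetSum _ fun i _ => hum i, Finset.sum_congr rfl hmean, Finset.sum_const,
            nsmul_eq_mul]
          ring
  exact (ENNReal.mul_le_mul_iff_right hcard (ENNReal.natCast_ne_top _)).1 hsum

/-- The conformal inequality: the probability that at least `τ * #J` members of `J` score strictly
less than `o` is at most `1 - τ`. -/
theorem measure_large_le {ι S : Type*} [DecidableEq ι] [MeasurableSpace S]
    (P : Measure (ι → S)) [IsProbabilityMeasure P] (J : Finset ι) {o : ι} (ho : o ∈ J)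
    (hP : ∀ i ∈ J, P.map (fun v => v ∘ Equiv.swap o i) = P)
    (t : (ι → S) → ι → ℝ) (ht : ∀ i, Measurable fun v => t v i)
    (htσ : ∀ i ∈ J, ∀ v j, t (v ∘ Equiv.swap o i) j = t v (Equiv.swap o i j))
    {τ : ℝ} (hτ : τ ≤ 1) :
    P {v | τ * (J.card : ℝ) ≤ ∑ j ∈ J with t v j < t v o, (1 : ℝ)} ≤ ENNReal.ofReal (1 - τ) := by
  have := lintegral_weight_of_large_le P J ho hP (fun _ => 1) measurable_const
    (fun _ => zero_le_one) t ht htσ hτ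
  simpa using this

end TriplyRobust

/-! ### Coverage of naive CP -/

namespace TriplyRobust

/-- Subadditivity is enough, so neither the miss event nor the coverage event has to be measurable.
-/
lemma one_sub_le_real_of_compl_subset {Ω : Type*} [MeasurableSpace Ω] {μ : Measure Ω}
    [IsProbabilityMeasure μ] {α : ℝ} (hα : 0 ≤ α) {B G : Set Ω} (hB : μ B ≤ ENNReal.ofReal α)
    (h : ∀ ω, ω ∉ B → ω ∈ G) : 1 - α ≤ μ.real G := by
  have h1 : (1 : ENNReal) ≤ μ B + μ G := by
    rw [← measure_univ (μ := μ)]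
    refine (measure_mono fun ω _ => ?_).trans (measure_union_le B G)
    by_cases hω : ω ∈ B
    · exact Or.inl hω
    · exact Or.inr (h ω hω)
  have h2 : (1 : ℝ) ≤ μ.real B + μ.real G := by
    rw [Measure.real, Measure.real, ← ENNReal.toReal_add (measure_ne_top _ _) (measure_ne_top _ _)]
    simpa using ENNReal.toReal_mono (ENNReal.add_ne_top.2 ⟨measure_ne_top _ _, measure_ne_top _ _⟩) h1
  have h3 : μ.real B ≤ α := ENNReal.toReal_le_of_le_ofReal hα hB
  linarith

namespace Experiment

variable {Ω 𝒳 𝒵 𝓕 : Type*} [MeasurableSpace Ω] [MeasurableSpace 𝒳] [MeasurableSpace 𝒵] {n : ℕ}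

lemma measurable_sample (D : Experiment Ω 𝒳 𝒵 𝓕 n) (i : Fin (n + 1)) : Measurable (D.sample i) :=
  (D.measurable_X i).prodMk ((D.measurable_Y i).prodMk ((D.measurable_Yobs i).prodMk
    ((D.measurable_Z i).prodMk (D.measurable_M i))))

lemma measurable_testScore (D : Experiment Ω 𝒳 𝒵 𝓕 n) : Measurable D.testScore :=
  D.measurable_score.comp (D.measurable_trainData.prodMk
    ((D.measurable_X (Fin.last n)).prodMk (D.measurable_Y (Fin.last n))))

lemma measurable_calScore (D : Experiment Ω 𝒳 𝒵 𝓕 n) (i : Fin n) : Measurable (D.calScore i) :=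
  D.measurable_score.comp (D.measurable_trainData.prodMk
    ((D.measurable_X i.castSucc).prodMk (D.measurable_Yobs i.castSucc)))

lemma measurableSet_cleanCal_eq (D : Experiment Ω 𝒳 𝒵 𝓕 n) (A : Finset (Fin n)) :
    MeasurableSet {ω | D.cleanCal ω = A} := by
  have h : {ω | D.cleanCal ω = A}
      = ⋂ i, {ω | (i ∈ D.I₂ ∧ D.M i.castSucc ω = 0) ↔ i ∈ A} := by
    ext ω
    simp [cleanCal, Finset.ext_iff]
  rw [h]
  refine MeasurableSet.iInter fun i => ?_
  have h0 : MeasurableSet {ω | D.M i.castSucc ω = 0} :=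
    D.measurable_M i.castSucc (measurableSet_singleton 0)
  by_cases h1 : i ∈ D.I₂ <;> by_cases h2 : i ∈ A <;> simp only [h1, h2, true_and, false_and, iff_true,
    iff_false]
  · exact h0
  · exact h0.compl
  · exact MeasurableSet.const _
  · exact MeasurableSet.const _

/-- Naive CP misses the test label with conditional probability at most `α`, given the set of clean
calibration points. -/
lemma measure_naive_miss_le (D : Experiment Ω 𝒳 𝒵 𝓕 n) (μ : Measure Ω)
    [IsProbabilityMeasure μ] {α : ℝ} (hα₀ : 0 < α) (hα₁ : α < 1) (h : D.ScoresExchangeable μ)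
    (A : Finset (Fin n)) :
    μ ({ω | D.cleanCal ω = A} ∩ {ω | ¬ (D.testScore ω : EReal)
        ≤ cpThreshold α (D.cleanCal ω) (fun i => D.calScore i ω)})
      ≤ ENNReal.ofReal α * μ {ω | D.cleanCal ω = A} := by
  classical
  set E := {ω | D.cleanCal ω = A} with hE
  have hEm : MeasurableSet E := D.measurableSet_cleanCal_eq A
  by_cases hE0 : μ E = 0
  · rw [measure_mono_null Set.inter_subset_left hE0]
    exact zero_le
  have : IsProbabilityMeasure (μ[|E]) := cond_isProbabilityMeasure hE0
  set ξ : Ω → Option A → ℝ := fun ω o => o.elim (D.testScore ω) (fun i => D.calScore i.1 ω) with hξ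
  have hξm : Measurable ξ := by
    refine measurable_pi_lambda _ fun o => ?_
    cases o with
    | none => exact D.measurable_testScore
    | some i => exact D.measurable_calScore i.1
  have hP : ∀ i ∈ (Finset.univ : Finset (Option A)),
      ((μ[|E]).map ξ).map (fun v => v ∘ Equiv.swap none i) = (μ[|E]).map ξ := by
    intro i _
    have hσ : Measurable fun v : Option A → ℝ => v ∘ Equiv.swap none i :=
      measurable_pi_lambda _ fun j => measurable_pi_apply _
    rw [Measure.map_map hσ hξm]
    exact (h A (Equiv.swap none i)).map_eq
  have : IsProbabilityMeasure ((μ[|E]).map ξ) := Measure.isProbabilityMeasure_map hξm.aemeasurable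
  have key := measure_large_le ((μ[|E]).map ξ) Finset.univ (Finset.mem_univ none) hP
    (fun v j => v j) (fun j => measurable_pi_apply j) (fun i _ v j => rfl) (τ := 1 - α)
    (by linarith)
  rw [Measure.map_apply hξm, sub_sub_cancel] at key
  · rw [← cond_mul_eq_inter hEm]
    gcongr
    refine le_trans ?_ key
    rw [cond_apply hEm, cond_apply hEm]
    gcongr _ * μ ?_
    rintro ω ⟨hω, hbad⟩
    refine ⟨hω, ?_⟩
    change D.cleanCal ω = A at hω
    change ¬ _ at hbad
    rw [hω, le_cpThreshold_iff hα₁, not_lt] at hbad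
    change (1 - α) * ((Finset.univ : Finset (Option A)).card : ℝ)
      ≤ ∑ j with ξ ω j < ξ ω none, (1 : ℝ)
    rw [Finset.card_univ, Fintype.card_option, Fintype.card_coe]
    push_cast
    refine hbad.trans_eq ?_
    -- The test index `none` adds one to the cardinality but nothing to the count, because the
    -- comparison is strict.
    rw [Finset.sum_filter, Finset.sum_filter, Fintype.sum_option, ← Finset.sum_attach A]
    simp [hξ]
  · simp only [Finset.sum_filter]
    refine measurableSet_le measurable_const (Finset.measurable_sum _ fun j _ => ?_)
    exact Measurable.ite (measurableSet_lt (by fun_prop) (by fun_prop)) measurable_const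
      measurable_const

lemma naiveSet_coverage (D : Experiment Ω 𝒳 𝒵 𝓕 n) (μ : Measure Ω)
    [IsProbabilityMeasure μ] {α : ℝ} (hα₀ : 0 < α) (hα₁ : α < 1) (h : D.ScoresExchangeable μ) :
    1 - α ≤ μ.real {ω | D.Y (Fin.last n) ω ∈ D.naiveSet α ω (D.X (Fin.last n) ω)} := by
  refine one_sub_le_real_of_compl_subset hα₀.le (B := {ω | ¬ (D.testScore ω : EReal)
        ≤ cpThreshold α (D.cleanCal ω) (fun i => D.calScore i ω)}) ?_ fun ω hω => not_not.1 hω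
  set B := {ω | ¬ (D.testScore ω : EReal)
        ≤ cpThreshold α (D.cleanCal ω) (fun i => D.calScore i ω)} with hB
  have hcover : B ⊆ ⋃ A ∈ (Finset.univ : Finset (Finset (Fin n))), {ω | D.cleanCal ω = A} ∩ B := by
    intro ω hω
    simp only [Set.mem_iUnion]
    exact ⟨D.cleanCal ω, Finset.mem_univ _, rfl, hω⟩
  have htot : ∑ A : Finset (Fin n), μ {ω | D.cleanCal ω = A} = 1 := by
    rw [← measure_biUnion_finset ?_ fun A _ => D.measurableSet_cleanCal_eq A]
    · rw [← measure_univ (μ := μ)]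
      congr 1
      ext ω
      simp
    · intro A _ A' _ hne
      refine Set.disjoint_left.2 fun ω h1 h2 => hne ?_
      exact h1.symm.trans h2
  calc μ B ≤ μ (⋃ A ∈ (Finset.univ : Finset (Finset (Fin n))), {ω | D.cleanCal ω = A} ∩ B) :=
        measure_mono hcover
    _ ≤ ∑ A : Finset (Fin n), μ ({ω | D.cleanCal ω = A} ∩ B) := measure_biUnion_finset_le _ _
    _ ≤ ∑ A : Finset (Fin n), ENNReal.ofReal α * μ {ω | D.cleanCal ω = A} :=
        Finset.sum_le_sum fun A _ => D.measure_naive_miss_le μ hα₀ hα₁ h A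
    _ = ENNReal.ofReal α := by rw [← Finset.mul_sum, htot, mul_one]

end Experiment

end TriplyRobust

/-! ### Conditional independence as a disintegration -/

namespace TriplyRobust

section Conditional

variable {Ω β γ δ : Type*} [MeasurableSpace Ω] [MeasurableSpace β] [MeasurableSpace γ]
  [MeasurableSpace δ]

lemma lintegral_of_map_eq_compProd {μ : Measure Ω} [SFinite μ] {W : Ω → β} {V : Ω → δ}
    (hW : Measurable W) (hV : Measurable V) {κ : Kernel β δ} [IsSFiniteKernel κ]
    (h : μ.map (fun ω => (W ω, V ω)) = μ.map W ⊗ₘ κ) {F : β × δ → ENNReal} (hF : Measurable F) :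
    ∫⁻ ω, F (W ω, V ω) ∂μ = ∫⁻ ω, ∫⁻ v, F (W ω, v) ∂(κ (W ω)) ∂μ := by
  rw [← lintegral_map (μ := μ) hF (hW.prodMk hV), h, Measure.lintegral_compProd hF,
    lintegral_map hF.lintegral_kernel_prod_right' hW]

lemma lintegral_condDistrib [StandardBorelSpace δ] [Nonempty δ] (μ : Measure Ω) [IsFiniteMeasure μ]
    {W : Ω → β} {V : Ω → δ} (hW : Measurable W) (hV : Measurable V) {F : β × δ → ENNReal}
    (hF : Measurable F) :
    ∫⁻ ω, F (W ω, V ω) ∂μ = ∫⁻ ω, ∫⁻ v, F (W ω, v) ∂(condDistrib V W μ (W ω)) ∂μ :=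
  lintegral_of_map_eq_compProd hW hV (compProd_map_condDistrib hV.aemeasurable).symm hF

/-- If `g` and `f` are conditionally independent given `k`, then the conditional law of `f` given
`(k, g)` is the conditional law of `f` given `k`. Only the target of `f` has to be standard Borel. -/
theorem map_eq_compProd_of_condIndepFun [StandardBorelSpace Ω] [StandardBorelSpace δ] [Nonempty δ]
    {μ : Measure Ω} [IsFiniteMeasure μ] {k : Ω → γ} {g : Ω → β} {f : Ω → δ} (hk : Measurable k)
    (hg : Measurable g) (hf : Measurable f)
    (h : CondIndepFun (MeasurableSpace.comap k inferInstance) hk.comap_le g f μ) :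
    μ.map (fun ω => ((k ω, g ω), f ω))
      = μ.map (fun ω => (k ω, g ω)) ⊗ₘ (condDistrib f k μ).prodMkRight β := by
  rw [Measure.ext_prod₃_iff']
  intro s t u hs ht hu
  -- On a rectangle only the event `g ∈ t` matters. Its real-valued indicator inherits the
  -- conditional independence and has a standard Borel target, whatever `β` is.
  set g' : Ω → ℝ := fun ω => t.indicator (fun _ => (1 : ℝ)) (g ω) with hg'
  have hi : Measurable (t.indicator (fun _ => (1 : ℝ))) := measurable_const.indicator ht
  have hg'm : Measurable g' := hi.comp hg
  have h' : CondIndepFun (MeasurableSpace.comap k inferInstance) hk.comap_le g' f μ :=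
    h.comp hi measurable_id
  have key := (condDistrib_ae_eq_iff_measure_eq_compProd (fun ω => (k ω, g' ω)) hf.aemeasurable
    _).1 ((condIndepFun_iff_condDistrib_prod_ae_eq_prodMkRight hf hg'm hk).1 h')
  have e : ∀ ω, g ω ∈ t ↔ g' ω ∈ ({1} : Set ℝ) := by
    intro ω
    by_cases hω : g ω ∈ t <;> simp [hg', hω]
  have h1 := congrArg (fun m => m ((s ×ˢ ({1} : Set ℝ)) ×ˢ u)) key
  have hs1 : MeasurableSet (s ×ˢ ({1} : Set ℝ)) := hs.prod (measurableSet_singleton 1)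
  rw [Measure.map_apply (by fun_prop) (hs1.prod hu), Measure.compProd_apply_prod hs1 hu,
    setLIntegral_map hs1 (Kernel.measurable_coe _ hu) (by fun_prop)] at h1
  rw [Measure.map_apply (by fun_prop) ((hs.prod ht).prod hu),
    Measure.compProd_apply_prod (hs.prod ht) hu,
    setLIntegral_map (hs.prod ht) (Kernel.measurable_coe _ hu) (by fun_prop)]
  convert! h1 using 2
  · ext ω
    simp [e ω]
  · congr 1
    ext ω
    simp [e ω]

end Conditional

/-! ### Sample vectors, transpositions and the true weight -/

namespace Experiment

variable {Ω 𝒳 𝒵 𝓕 : Type*} [MeasurableSpace Ω] [MeasurableSpace 𝒳] [MeasurableSpace 𝒵] {n : ℕ}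

/-- The part of a vector of sample points on which the models are fitted. -/
def vecTrain (D : Experiment Ω 𝒳 𝒵 𝓕 n) (v : Fin (n + 1) → 𝒳 × ℝ × ℝ × 𝒵 × Fin 2) :
    D.I₁ → 𝒳 × ℝ × 𝒵 × Fin 2 :=
  fun i => ((v i.1.castSucc).1, (v i.1.castSucc).2.2.1, (v i.1.castSucc).2.2.2.1,
    (v i.1.castSucc).2.2.2.2)

/-- The score of the observed label of the `j`-th point in a vector of sample points. -/
def vecScore (D : Experiment Ω 𝒳 𝒵 𝓕 n) (v : Fin (n + 1) → 𝒳 × ℝ × ℝ × 𝒵 × Fin 2)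
    (j : Fin (n + 1)) : ℝ :=
  D.score (v j).1 (v j).2.2.1 (D.fhat (D.vecTrain v))

lemma measurable_vecTrain (D : Experiment Ω 𝒳 𝒵 𝓕 n) : Measurable D.vecTrain := by
  refine measurable_pi_lambda _ fun i => ?_
  unfold vecTrain
  fun_prop

lemma measurable_vecScore (D : Experiment Ω 𝒳 𝒵 𝓕 n) (j : Fin (n + 1)) :
    Measurable fun v => D.vecScore v j := by
  refine D.measurable_score.comp (D.measurable_vecTrain.prodMk (Measurable.prodMk ?_ ?_)) <;>
  fun_prop

/-- The calibration indices in `K` together with the test index. -/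
def withTest (K : Finset (Fin n)) : Finset (Fin (n + 1)) :=
  insert (Fin.last n) (K.map Fin.castSuccEmb)

lemma last_notMem_map (K : Finset (Fin n)) : Fin.last n ∉ K.map Fin.castSuccEmb := by
  simp [Fin.castSucc_ne_last]

lemma sum_withTest {A : Type*} [AddCommMonoid A] (K : Finset (Fin n)) (f : Fin (n + 1) → A) :
    ∑ j ∈ withTest K, f j = f (Fin.last n) + ∑ i ∈ K, f i.castSucc := by
  rw [withTest, Finset.sum_insert (last_notMem_map K), Finset.sum_map]
  rfl

lemma card_withTest (K : Finset (Fin n)) : (withTest K).card = K.card + 1 := by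
  rw [withTest, Finset.card_insert_of_notMem (last_notMem_map K), Finset.card_map]

lemma last_mem_withTest (K : Finset (Fin n)) : Fin.last n ∈ withTest K :=
  Finset.mem_insert_self _ _

/-- The transposition moves only the test index and a member of `K`, neither of which is used for
fitting. -/
lemma vecTrain_comp_swap (D : Experiment Ω 𝒳 𝒵 𝓕 n) {K : Finset (Fin n)} (hK : Disjoint D.I₁ K)
    {i : Fin (n + 1)} (hi : i ∈ withTest K) (v : Fin (n + 1) → 𝒳 × ℝ × ℝ × 𝒵 × Fin 2) :
    D.vecTrain (v ∘ Equiv.swap (Fin.last n) i) = D.vecTrain v := by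
  have h : ∀ l : D.I₁, Equiv.swap (Fin.last n) i l.1.castSucc = l.1.castSucc := by
    intro l
    refine Equiv.swap_apply_of_ne_of_ne (Fin.castSucc_ne_last _) ?_
    rintro rfl
    rw [withTest, Finset.mem_insert] at hi
    rcases hi with h1 | h1
    · exact Fin.castSucc_ne_last _ h1
    · obtain ⟨l', hl', he⟩ := Finset.mem_map.1 h1
      rw [Fin.castSucc_injective n he] at hl'
      exact Finset.disjoint_left.1 hK l.2 hl'
  funext l
  simp only [vecTrain, Function.comp, h l]

lemma vecScore_comp_swap (D : Experiment Ω 𝒳 𝒵 𝓕 n) {K : Finset (Fin n)} (hK : Disjoint D.I₁ K)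
    {i : Fin (n + 1)} (hi : i ∈ withTest K) (v : Fin (n + 1) → 𝒳 × ℝ × ℝ × 𝒵 × Fin 2)
    (j : Fin (n + 1)) :
    D.vecScore (v ∘ Equiv.swap (Fin.last n) i) j
      = D.vecScore v (Equiv.swap (Fin.last n) i j) := by
  simp only [vecScore, D.vecTrain_comp_swap hK hi, Function.comp]

lemma measurable_samples (D : Experiment Ω 𝒳 𝒵 𝓕 n) : Measurable fun ω i => D.sample i ω :=
  measurable_pi_lambda _ D.measurable_sample

lemma map_samples_comp_swap (D : Experiment Ω 𝒳 𝒵 𝓕 n) {μ : Measure Ω}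
    (hexch : Exchangeable μ D.sample) (i j : Fin (n + 1)) :
    (μ.map fun ω l => D.sample l ω).map (fun v => v ∘ Equiv.swap i j)
      = μ.map fun ω l => D.sample l ω := by
  have hσ : Measurable fun v : Fin (n + 1) → 𝒳 × ℝ × ℝ × 𝒵 × Fin 2 => v ∘ Equiv.swap i j :=
    measurable_pi_lambda _ fun j => measurable_pi_apply _
  rw [Measure.map_map hσ D.measurable_samples]
  exact (hexch (Equiv.swap i j)).map_eq

lemma map_sample_eq (D : Experiment Ω 𝒳 𝒵 𝓕 n) {μ : Measure Ω}
    (hexch : Exchangeable μ D.sample) (i : Fin (n + 1)) :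
    μ.map (D.sample i) = μ.map (D.sample (Fin.last n)) := by
  have h := congrArg (fun m => m.map fun v => v (Fin.last n))
    (D.map_samples_comp_swap hexch (Fin.last n) i)
  have hσ : Measurable fun v : Fin (n + 1) → 𝒳 × ℝ × ℝ × 𝒵 × Fin 2 =>
      v ∘ Equiv.swap (Fin.last n) i := measurable_pi_lambda _ fun j => measurable_pi_apply _
  rw [Measure.map_map (measurable_pi_apply _) hσ,
    Measure.map_map ((measurable_pi_apply _).comp hσ) D.measurable_samples,
    Measure.map_map (measurable_pi_apply _) D.measurable_samples] at h
  convert! h using 2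
  funext ω
  simp

lemma map_ZM_eq (D : Experiment Ω 𝒳 𝒵 𝓕 n) {μ : Measure Ω}
    (hexch : Exchangeable μ D.sample) (i : Fin (n + 1)) :
    μ.map (fun ω => (D.Z i ω, D.M i ω))
      = μ.map (fun ω => (D.Z (Fin.last n) ω, D.M (Fin.last n) ω)) := by
  have h := congrArg (fun m => m.map fun s : 𝒳 × ℝ × ℝ × 𝒵 × Fin 2 => (s.2.2.2.1, s.2.2.2.2))
    (D.map_sample_eq hexch i)
  rwa [Measure.map_map (by fun_prop) (D.measurable_sample _),
    Measure.map_map (by fun_prop) (D.measurable_sample _)] at h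

/-- The probability of being clean given the privileged information of a point. -/
def cleanProb (D : Experiment Ω 𝒳 𝒵 𝓕 n) (μ : Measure Ω) [IsFiniteMeasure μ] (z : 𝒵) : ℝ :=
  (condDistrib (D.M (Fin.last n)) (D.Z (Fin.last n)) μ z).real {0}

lemma measurable_cleanProb (D : Experiment Ω 𝒳 𝒵 𝓕 n) (μ : Measure Ω) [IsFiniteMeasure μ] :
    Measurable (D.cleanProb μ) :=
  (Kernel.measurable_coe _ (measurableSet_singleton 0)).ennreal_toReal

lemma cleanProb_nonneg (D : Experiment Ω 𝒳 𝒵 𝓕 n) (μ : Measure Ω) [IsFiniteMeasure μ] (z : 𝒵) :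
    0 ≤ D.cleanProb μ z := measureReal_nonneg

/-- `condDistrib` is built from the joint law alone, so equal laws give literally the same kernel.
-/
lemma condDistrib_M_eq (D : Experiment Ω 𝒳 𝒵 𝓕 n) {μ : Measure Ω} [IsFiniteMeasure μ]
    (hexch : Exchangeable μ D.sample) (i : Fin (n + 1)) :
    condDistrib (D.M i) (D.Z i) μ = condDistrib (D.M (Fin.last n)) (D.Z (Fin.last n)) μ := by
  simp only [condDistrib, D.map_ZM_eq hexch i]

lemma measure_clean_eq (D : Experiment Ω 𝒳 𝒵 𝓕 n) {μ : Measure Ω}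
    (hexch : Exchangeable μ D.sample) (i : Fin (n + 1)) :
    μ {ω | D.M i ω = 0} = μ {ω | D.M (Fin.last n) ω = 0} := by
  have h := congrArg (fun m => m (Prod.snd ⁻¹' {0})) (D.map_ZM_eq hexch i)
  have hm : MeasurableSet (Prod.snd ⁻¹' {0} : Set (𝒵 × Fin 2)) :=
    measurable_snd (measurableSet_singleton 0)
  rwa [Measure.map_apply ((D.measurable_Z _).prodMk (D.measurable_M _)) hm,
    Measure.map_apply ((D.measurable_Z _).prodMk (D.measurable_M _)) hm] at h

/-- The weighted conformal inequality needs one weight function of a single point, common to all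
indices; exchangeability provides it. -/
lemma trueWeight_ae_eq (D : Experiment Ω 𝒳 𝒵 𝓕 n) {μ : Measure Ω} [IsFiniteMeasure μ]
    (hexch : Exchangeable μ D.sample) (i : Fin (n + 1)) :
    D.trueWeight μ i =ᵐ[μ]
      fun ω => μ.real {ω | D.M (Fin.last n) ω = 0} / D.cleanProb μ (D.Z i ω) := by
  have h := condDistrib_ae_eq_condExp (μ := μ) (D.measurable_Z i) (D.measurable_M i)
    (measurableSet_singleton (0 : Fin 2))
  rw [D.condDistrib_M_eq hexch i] at h
  filter_upwards [h] with ω hω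
  rw [trueWeight, cleanProb, hω, Measure.real, D.measure_clean_eq hexch i]
  rfl

/-- The set where the clean probability vanishes is null for the law of `Z` given `M = 0`, hence
null for the law of `Z` by absolute continuity. -/
lemma ae_cleanProb_pos (D : Experiment Ω 𝒳 𝒵 𝓕 n) {μ : Measure Ω} [IsFiniteMeasure μ]
    (hac : μ.map (D.Z (Fin.last n)) ≪
      (μ[|{ω | D.M (Fin.last n) ω = 0}]).map (D.Z (Fin.last n))) :
    ∀ᵐ z ∂(μ.map (D.Z (Fin.last n))), 0 < D.cleanProb μ z := by
  set κ := condDistrib (D.M (Fin.last n)) (D.Z (Fin.last n)) μ with hκ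
  have hZ := D.measurable_Z (Fin.last n)
  have hM := D.measurable_M (Fin.last n)
  have hNm : MeasurableSet {z | κ z {0} = 0} :=
    Kernel.measurable_coe κ (measurableSet_singleton 0) (measurableSet_singleton 0)
  have h0 : μ (D.Z (Fin.last n) ⁻¹' {z | κ z {0} = 0} ∩ D.M (Fin.last n) ⁻¹' {0}) = 0 := by
    rw [← setLIntegral_preimage_condDistrib hZ hM.aemeasurable (measurableSet_singleton 0) hNm,
      setLIntegral_congr_fun (hZ hNm) (g := fun _ => 0) fun ω hω => hω]
    simp
  have h1 : μ.map (D.Z (Fin.last n)) {z | κ z {0} = 0} = 0 := by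
    refine hac ?_
    rw [Measure.map_apply hZ hNm, cond_apply (show MeasurableSet {ω | D.M (Fin.last n) ω = 0} from hM (measurableSet_singleton 0))]
    rw [Set.inter_comm] at h0
    exact mul_eq_zero_of_right _ h0
  rw [ae_iff]
  refine measure_mono_null (fun z hz => ?_) h1
  have h2 : D.cleanProb μ z = 0 := le_antisymm (not_lt.1 hz) (D.cleanProb_nonneg μ z)
  rw [cleanProb, measureReal_eq_zero_iff] at h2
  exact h2

/-- Conditioning on a null event yields the zero measure, which cannot dominate the law of `Z`. -/
lemma measure_clean_pos (D : Experiment Ω 𝒳 𝒵 𝓕 n) {μ : Measure Ω} [IsProbabilityMeasure μ]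
    (hac : μ.map (D.Z (Fin.last n)) ≪
      (μ[|{ω | D.M (Fin.last n) ω = 0}]).map (D.Z (Fin.last n))) :
    0 < μ.real {ω | D.M (Fin.last n) ω = 0} := by
  refine lt_of_le_of_ne measureReal_nonneg fun h => ?_
  have h0 : μ {ω | D.M (Fin.last n) ω = 0} = 0 := by
    rwa [eq_comm, measureReal_eq_zero_iff] at h
  rw [cond_eq_zero_of_meas_eq_zero h0, Measure.map_zero, Measure.absolutelyContinuous_zero_iff,
    Measure.map_eq_zero_iff (D.measurable_Z _).aemeasurable] at hac
  exact IsProbabilityMeasure.ne_zero μ hac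

end Experiment

end TriplyRobust

/-! ### Coverage of PCP -/

namespace TriplyRobust

namespace Experiment

variable {Ω 𝒳 𝒵 𝓕 : Type*} [MeasurableSpace Ω] [MeasurableSpace 𝒳] [MeasurableSpace 𝒵] {n : ℕ}

/-- The true weight as a function of the privileged information. -/
def weightFn (D : Experiment Ω 𝒳 𝒵 𝓕 n) (μ : Measure Ω) [IsFiniteMeasure μ] (z : 𝒵) : ℝ :=
  μ.real {ω | D.M (Fin.last n) ω = 0} / D.cleanProb μ z

lemma measurable_weightFn (D : Experiment Ω 𝒳 𝒵 𝓕 n) (μ : Measure Ω) [IsFiniteMeasure μ] :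
    Measurable (D.weightFn μ) := measurable_const.div (D.measurable_cleanProb μ)

lemma weightFn_nonneg (D : Experiment Ω 𝒳 𝒵 𝓕 n) (μ : Measure Ω) [IsFiniteMeasure μ] (z : 𝒵) :
    0 ≤ D.weightFn μ z := div_nonneg measureReal_nonneg (D.cleanProb_nonneg μ z)

/-- The weight of a sample point for weighted conformal prediction on the clean points. -/
def cleanWeight (D : Experiment Ω 𝒳 𝒵 𝓕 n) (μ : Measure Ω) [IsFiniteMeasure μ]
    (s : 𝒳 × ℝ × ℝ × 𝒵 × Fin 2) : ℝ :=
  if s.2.2.2.2 = 0 then D.weightFn μ s.2.2.2.1 else 0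

lemma measurable_cleanWeight (D : Experiment Ω 𝒳 𝒵 𝓕 n) (μ : Measure Ω) [IsFiniteMeasure μ] :
    Measurable (D.cleanWeight μ) := by
  refine Measurable.ite ?_ ((D.measurable_weightFn μ).comp (by fun_prop)) measurable_const
  exact (show Measurable fun s : 𝒳 × ℝ × ℝ × 𝒵 × Fin 2 => s.2.2.2.2 by fun_prop)
    (measurableSet_singleton 0)

lemma cleanWeight_nonneg (D : Experiment Ω 𝒳 𝒵 𝓕 n) (μ : Measure Ω) [IsFiniteMeasure μ]
    (s : 𝒳 × ℝ × ℝ × 𝒵 × Fin 2) : 0 ≤ D.cleanWeight μ s := by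
  unfold cleanWeight
  split_ifs
  · exact D.weightFn_nonneg μ _
  · exact le_rfl

/-- The vectors of sample points in which the clean calibration points with a score smaller than
that of the test point carry a fraction `τ` of the total weight of the clean points. -/
def weightedMiss (D : Experiment Ω 𝒳 𝒵 𝓕 n) (μ : Measure Ω) [IsFiniteMeasure μ] (τ : ℝ) :
    Set (Fin (n + 1) → 𝒳 × ℝ × ℝ × 𝒵 × Fin 2) :=
  {v | τ * ∑ j ∈ withTest D.I₂, D.cleanWeight μ (v j)
    ≤ ∑ j ∈ withTest D.I₂ with D.vecScore v j < D.vecScore v (Fin.last n), D.cleanWeight μ (v j)}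

lemma measurableSet_weightedMiss (D : Experiment Ω 𝒳 𝒵 𝓕 n) (μ : Measure Ω) [IsFiniteMeasure μ]
    (τ : ℝ) : MeasurableSet (D.weightedMiss μ τ) := by
  have hu := D.measurable_cleanWeight μ
  simp only [weightedMiss, Finset.sum_filter]
  refine measurableSet_le (by fun_prop) (Finset.measurable_sum _ fun j _ => ?_)
  exact Measurable.ite (measurableSet_lt (D.measurable_vecScore _) (D.measurable_vecScore _))
    (by fun_prop) measurable_const

/-- The vector of sample points in which the test point is replaced by a clean one with covariates,
label and privileged information `x, y, z`. -/
def cleanTest (p : 𝒵 × ((𝒳 × ℝ) × ({j : Fin (n + 1) // j ≠ Fin.last n} →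
    𝒳 × ℝ × ℝ × 𝒵 × Fin 2))) (j : Fin (n + 1)) : 𝒳 × ℝ × ℝ × 𝒵 × Fin 2 :=
  if h : j = Fin.last n then (p.2.1.1, p.2.1.2, p.2.1.2, p.1, 0) else p.2.2 ⟨j, h⟩

lemma measurable_cleanTest : Measurable (cleanTest (𝒳 := 𝒳) (𝒵 := 𝒵) (n := n)) := by
  refine measurable_pi_lambda _ fun j => ?_
  by_cases h : j = Fin.last n
  · simp only [cleanTest, h, dite_true]
    fun_prop
  · simp only [cleanTest, h, dite_false]
    fun_prop

/-- The sample points, the test point being made clean. -/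
def cleanedSamples (D : Experiment Ω 𝒳 𝒵 𝓕 n) (ω : Ω) :
    Fin (n + 1) → 𝒳 × ℝ × ℝ × 𝒵 × Fin 2 :=
  cleanTest (D.Z (Fin.last n) ω, ((D.X (Fin.last n) ω, D.Y (Fin.last n) ω),
    fun j => D.sample j.1 ω))

lemma cleanedSamples_last (D : Experiment Ω 𝒳 𝒵 𝓕 n) (ω : Ω) :
    D.cleanedSamples ω (Fin.last n) = (D.X (Fin.last n) ω, D.Y (Fin.last n) ω,
      D.Y (Fin.last n) ω, D.Z (Fin.last n) ω, 0) := by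
  simp [cleanedSamples, cleanTest]

lemma cleanedSamples_castSucc (D : Experiment Ω 𝒳 𝒵 𝓕 n) (ω : Ω) (i : Fin n) :
    D.cleanedSamples ω i.castSucc = D.sample i.castSucc ω := by
  simp [cleanedSamples, cleanTest, Fin.castSucc_ne_last]

lemma cleanedSamples_of_clean (D : Experiment Ω 𝒳 𝒵 𝓕 n) (ω : Ω)
    (h : D.M (Fin.last n) ω = 0) : D.cleanedSamples ω = fun j => D.sample j ω := by
  funext j
  refine Fin.lastCases ?_ (fun i => ?_) j
  · rw [cleanedSamples_last, sample, h, D.Yobs_eq_of_clean _ _ h]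
  · rw [cleanedSamples_castSucc]

lemma vecTrain_cleanedSamples (D : Experiment Ω 𝒳 𝒵 𝓕 n) (ω : Ω) :
    D.vecTrain (D.cleanedSamples ω) = D.trainData ω := by
  funext i
  simp only [vecTrain, cleanedSamples_castSucc]
  rfl

/-- The privileged information weights turn weighted conformal prediction on the clean points into a
procedure that is valid for the test point. -/
theorem measure_weightedMiss_le [StandardBorelSpace Ω] (D : Experiment Ω 𝒳 𝒵 𝓕 n) (μ : Measure Ω)
    [IsProbabilityMeasure μ] (h : D.PCPAssumptions μ) {τ : ℝ} (hτ : τ ≤ 1) :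
    μ {ω | D.cleanedSamples ω ∈ D.weightedMiss μ τ} ≤ ENNReal.ofReal (1 - τ) := by
  set c := μ.real {ω | D.M (Fin.last n) ω = 0} with hc
  have hc0 : 0 < c := D.measure_clean_pos h.absolutelyContinuous
  have hZ := D.measurable_Z (Fin.last n)
  have hM := D.measurable_M (Fin.last n)
  have hpos : ∀ᵐ ω ∂μ, 0 < D.cleanProb μ (D.Z (Fin.last n) ω) :=
    ae_of_ae_map hZ.aemeasurable (D.ae_cleanProb_pos h.absolutelyContinuous)
  have hu := D.measurable_cleanWeight μ
  have hB := D.measurableSet_weightedMiss μ τ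
  -- The change of measure: given everything but the test indicator, the factor `w(Z)` on `M = 0`
  -- integrates to `w(Z) P(M = 0 | Z) = c`. On a clean test point the sample vector and the cleaned
  -- one coincide.
  have hmass : ∀ (A : Set (Fin (n + 1) → 𝒳 × ℝ × ℝ × 𝒵 × Fin 2)), MeasurableSet A →
      ∫⁻ v in A, ENNReal.ofReal (D.cleanWeight μ (v (Fin.last n)))
        ∂(μ.map fun ω j => D.sample j ω)
      = ENNReal.ofReal c * μ {ω | D.cleanedSamples ω ∈ A} := by
    intro A hA
    set g : Ω → (𝒳 × ℝ) × ({j : Fin (n + 1) // j ≠ Fin.last n} → 𝒳 × ℝ × ℝ × 𝒵 × Fin 2) :=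
      fun ω => ((D.X (Fin.last n) ω, D.Y (Fin.last n) ω), fun j => D.sample j.1 ω) with hg
    have hgm : Measurable g := ((D.measurable_X _).prodMk (D.measurable_Y _)).prodMk
      (measurable_pi_lambda _ fun j => D.measurable_sample j.1)
    have hW : Measurable fun ω => (D.Z (Fin.last n) ω, g ω) := hZ.prodMk hgm
    have hcl : Measurable D.cleanedSamples := measurable_cleanTest.comp hW
    set F : (𝒵 × ((𝒳 × ℝ) × ({j : Fin (n + 1) // j ≠ Fin.last n} → 𝒳 × ℝ × ℝ × 𝒵 × Fin 2)))
        × Fin 2 → ENNReal := fun q => (cleanTest ⁻¹' A).indicator (fun _ => 1) q.1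
          * (ENNReal.ofReal (D.weightFn μ q.1.1) * ({0} : Set (Fin 2)).indicator 1 q.2) with hF
    have hFm : Measurable F := by
      have h1 : Measurable ((cleanTest (𝒳 := 𝒳) (𝒵 := 𝒵) (n := n) ⁻¹' A).indicator
        (fun _ => (1 : ENNReal))) := measurable_const.indicator (measurable_cleanTest hA)
      have h2 : Measurable (({0} : Set (Fin 2)).indicator (1 : Fin 2 → ENNReal)) :=
        measurable_one.indicator (measurableSet_singleton 0)
      have h3 := D.measurable_weightFn μ
      fun_prop
    have e1 : ∫⁻ v in A, ENNReal.ofReal (D.cleanWeight μ (v (Fin.last n)))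
        ∂(μ.map fun ω j => D.sample j ω)
        = ∫⁻ ω, F ((D.Z (Fin.last n) ω, g ω), D.M (Fin.last n) ω) ∂μ := by
      rw [← lintegral_indicator hA, lintegral_map
        ((show Measurable fun v : Fin (n + 1) → 𝒳 × ℝ × ℝ × 𝒵 × Fin 2 =>
          ENNReal.ofReal (D.cleanWeight μ (v (Fin.last n))) by fun_prop).indicator hA)
        D.measurable_samples]
      refine lintegral_congr fun ω => ?_
      by_cases hω : D.M (Fin.last n) ω = 0
      · have h1 : (fun j => D.sample j ω) = cleanTest (D.Z (Fin.last n) ω, g ω) :=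
          (D.cleanedSamples_of_clean ω hω).symm
        have h2 : D.cleanWeight μ (D.sample (Fin.last n) ω)
            = D.weightFn μ (D.Z (Fin.last n) ω) := if_pos hω
        have h3 : (cleanTest ⁻¹' A).indicator (fun _ => (1 : ENNReal)) (D.Z (Fin.last n) ω, g ω)
            = A.indicator (fun _ => 1) (fun j => D.sample j ω) := by
          rw [h1]
          rfl
        simp only [hF, h3, hω]
        by_cases hωA : (fun j => D.sample j ω) ∈ A <;> simp [hωA, h2]
      · have h2 : D.cleanWeight μ (D.sample (Fin.last n) ω) = 0 := if_neg hω
        simp [hF, Set.indicator_apply, h2, hω]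
    rw [e1, lintegral_of_map_eq_compProd hW hM
      (map_eq_compProd_of_condIndepFun hZ hgm hM (h.condIndep (Fin.last n))) hFm]
    have e2 : (fun ω => ∫⁻ m, F ((D.Z (Fin.last n) ω, g ω), m)
        ∂((condDistrib (D.M (Fin.last n)) (D.Z (Fin.last n)) μ).prodMkRight
          ((𝒳 × ℝ) × ({j : Fin (n + 1) // j ≠ Fin.last n} → 𝒳 × ℝ × ℝ × 𝒵 × Fin 2)))
            (D.Z (Fin.last n) ω, g ω))
        =ᵐ[μ] fun ω => ENNReal.ofReal c * (D.cleanedSamples ⁻¹' A).indicator 1 ω := by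
      filter_upwards [hpos] with ω hω
      simp only [hF, Kernel.prodMkRight_apply]
      have h2 : Measurable (({0} : Set (Fin 2)).indicator (1 : Fin 2 → ENNReal)) :=
        measurable_one.indicator (measurableSet_singleton 0)
      rw [lintegral_const_mul _ (h2.const_mul _), lintegral_const_mul _ h2,
        lintegral_indicator_one (measurableSet_singleton 0), mul_comm]
      congr 1
      have h3 : condDistrib (D.M (Fin.last n)) (D.Z (Fin.last n)) μ (D.Z (Fin.last n) ω) {0}
          = ENNReal.ofReal (D.cleanProb μ (D.Z (Fin.last n) ω)) := by
        rw [cleanProb, ofReal_measureReal]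
      rw [h3, ← ENNReal.ofReal_mul (D.weightFn_nonneg μ _), weightFn, div_mul_cancel₀ _ hω.ne']
    rw [lintegral_congr_ae e2, lintegral_const_mul _ (measurable_one.indicator (hcl hA)),
      lintegral_indicator_one (hcl hA)]
    rfl
  have key := lintegral_weight_of_large_le (μ.map fun ω j => D.sample j ω) (withTest D.I₂)
    (last_mem_withTest D.I₂) (fun i _ => D.map_samples_comp_swap h.exchangeable _ i)
    (D.cleanWeight μ) hu (D.cleanWeight_nonneg μ) D.vecScore D.measurable_vecScore
    (fun i hi v j => D.vecScore_comp_swap D.disjoint_I₁_I₂ hi v j) hτ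
  change ∫⁻ v in D.weightedMiss μ τ, _ ∂_ ≤ _ at key
  -- The total weight of the test point is the case `A = univ`, with value `c`. So `c` appears on
  -- both sides and cancels.
  rw [hmass _ hB, ← setLIntegral_univ, hmass _ MeasurableSet.univ] at key
  simp only [Set.mem_univ, Set.ofPred_true, measure_univ, mul_one] at key
  rw [mul_comm (ENNReal.ofReal (1 - τ))] at key
  exact (ENNReal.mul_le_mul_iff_right (by simpa using hc0) ENNReal.ofReal_ne_top).1 key

/-- The weight of the test point rarely exceeds most of the weights of the calibration points. -/
lemma measure_large_weight_le (D : Experiment Ω 𝒳 𝒵 𝓕 n) (μ : Measure Ω)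
    [IsProbabilityMeasure μ] (hexch : Exchangeable μ D.sample) {τ : ℝ} (hτ : τ ≤ 1) :
    μ {ω | τ * ((D.I₂.card : ℝ) + 1) ≤ ∑ _i ∈ D.I₂ with
      D.weightFn μ (D.Z _i.castSucc ω) < D.weightFn μ (D.Z (Fin.last n) ω), (1 : ℝ)}
      ≤ ENNReal.ofReal (1 - τ) := by
  have hw := D.measurable_weightFn μ
  have : IsProbabilityMeasure (μ.map fun ω j => D.sample j ω) :=
    Measure.isProbabilityMeasure_map D.measurable_samples.aemeasurable
  have key := measure_large_le (μ.map fun ω j => D.sample j ω) (withTest D.I₂)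
    (last_mem_withTest D.I₂) (fun i _ => D.map_samples_comp_swap hexch _ i)
    (fun v j => D.weightFn μ (v j).2.2.2.1) (fun j => by fun_prop) (fun i hi v j => rfl) hτ
  rw [Measure.map_apply D.measurable_samples] at key
  · convert! key using 2
    ext ω
    simp only [Set.mem_ofPred_eq, Set.mem_preimage, card_withTest, Finset.sum_filter, sum_withTest,
      lt_irrefl, if_false, zero_add, Nat.cast_add, Nat.cast_one]
    rfl
  · simp only [Finset.sum_filter]
    refine measurableSet_le measurable_const (Finset.measurable_sum _ fun j _ => ?_)
    exact Measurable.ite (measurableSet_lt (by fun_prop) (by fun_prop)) measurable_const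
      measurable_const

/-- If weighted conformal prediction with the weight of the test point covers the test label, and
that weight does not exceed most of the weights of the calibration points, then PCP covers it. -/
lemma mem_pcpSet_of_notMem (D : Experiment Ω 𝒳 𝒵 𝓕 n) (μ : Measure Ω) [IsFiniteMeasure μ]
    {α β : ℝ} (hα₁ : α < 1) (hβ₀ : 0 < β) (hβ₁ : β < α) {ω : Ω}
    (hw : ∀ i ∈ D.I₂, D.w i ω = D.weightFn μ (D.Z i.castSucc ω))
    (hpos : ∀ i, 0 < D.weightFn μ (D.Z i ω))
    (h1 : D.cleanedSamples ω ∉ D.weightedMiss μ (1 - α + β))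
    (h2 : ¬ (1 - β) * ((D.I₂.card : ℝ) + 1) ≤ ∑ _i ∈ D.I₂ with
      D.weightFn μ (D.Z _i.castSucc ω) < D.weightFn μ (D.Z (Fin.last n) ω), (1 : ℝ)) :
    D.Y (Fin.last n) ω ∈ D.pcpSet α β ω (D.X (Fin.last n) ω) := by
  change (D.testScore ω : EReal) ≤ pcpThreshold α β D.I₂ (D.cleanCal ω)
    (fun i => D.calScore i ω) (fun i => D.w i ω)
  rw [pcpThreshold, le_augmentedQuantile_iff (by linarith)]
  have hτ : 0 < 1 - α + β := by linarith
  have hcw : ∀ i ∈ D.cleanCal ω, 0 ≤ D.w i ω := fun i hi => by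
    rw [hw i (Finset.mem_filter.1 hi).1]
    exact D.weightFn_nonneg μ _
  have hcov : (D.testScore ω : EReal) ≤ wcpThreshold (1 - α + β) (D.cleanCal ω)
      (fun i => D.calScore i ω) (fun i => D.w i ω) (D.weightFn μ (D.Z (Fin.last n) ω)) := by
    rw [le_wcpThreshold_iff hτ _ _ _ hcw (hpos _)]
    have hs : ∀ i : Fin n, D.vecScore (D.cleanedSamples ω) i.castSucc = D.calScore i ω := by
      intro i
      rw [vecScore, vecTrain_cleanedSamples, cleanedSamples_castSucc]
      rfl
    have hl : D.vecScore (D.cleanedSamples ω) (Fin.last n) = D.testScore ω := by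
      rw [vecScore, vecTrain_cleanedSamples, cleanedSamples_last]
      rfl
    -- The test point drops out of the sum of smaller scores but stays in the total weight, where it
    -- is the extra `w₀` of the weighted threshold.
    simp only [weightedMiss, Set.mem_ofPred_eq, not_le, Finset.sum_filter, sum_withTest, lt_irrefl,
      if_false, zero_add, hs, hl, cleanedSamples_last, cleanedSamples_castSucc] at h1
    have hcl : ∀ i ∈ D.I₂, D.cleanWeight μ (D.sample i.castSucc ω)
        = if D.M i.castSucc ω = 0 then D.w i ω else 0 := by
      intro i hi
      rw [hw i hi]
      rfl
    have e1 : ∑ i ∈ D.I₂, D.cleanWeight μ (D.sample i.castSucc ω) = ∑ i ∈ D.cleanCal ω, D.w i ω := by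
      rw [cleanCal, Finset.sum_filter]
      exact Finset.sum_congr rfl hcl
    have e2 : ∑ i ∈ D.I₂, (if D.calScore i ω < D.testScore ω
          then D.cleanWeight μ (D.sample i.castSucc ω) else 0)
        = ∑ i ∈ D.cleanCal ω with (D.calScore i ω : EReal) < D.testScore ω, D.w i ω := by
      rw [cleanCal, Finset.filter_filter, Finset.sum_filter]
      refine Finset.sum_congr rfl fun i hi => ?_
      rw [hcl i hi]
      by_cases ha : D.M i.castSucc ω = 0 <;> by_cases hb : D.calScore i ω < D.testScore ω <;>
      simp [ha, hb]
    have e3 : D.cleanWeight μ (D.X (Fin.last n) ω, D.Y (Fin.last n) ω, D.Y (Fin.last n) ω,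
        D.Z (Fin.last n) ω, 0) = D.weightFn μ (D.Z (Fin.last n) ω) := if_pos rfl
    rw [e1, e2, e3, add_comm (D.weightFn μ _)] at h1
    exact h1
  rw [not_le] at h2
  refine lt_of_le_of_lt ?_ h2
  -- A calibration point whose own threshold lies below the test score must have a smaller weight
  -- than the test point, by monotonicity of the threshold.
  refine Finset.sum_le_sum_of_subset_of_nonneg (fun i hi => ?_) fun _ _ _ => zero_le_one
  rw [Finset.mem_filter] at hi ⊢
  refine ⟨hi.1, ?_⟩
  by_contra! hle
  refine absurd (hcov.trans (wcpThreshold_mono hτ _ _ _ hcw (hpos _) hle)) (not_le.2 ?_)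
  have := hi.2
  rwa [hw i hi.1] at this

/-- The error budget splits as `α = (α - β) + β`: the first part pays for the threshold with the
test weight, the second for replacing that weight by the calibration weights. -/
theorem pcpSet_coverage [StandardBorelSpace Ω] (D : Experiment Ω 𝒳 𝒵 𝓕 n) (μ : Measure Ω)
    [IsProbabilityMeasure μ] {α β : ℝ} (hα₀ : 0 < α) (hα₁ : α < 1) (hβ₀ : 0 < β) (hβ₁ : β < α)
    (h : D.PCPAssumptions μ) :
    1 - α ≤ μ.real {ω | D.Y (Fin.last n) ω ∈ D.pcpSet α β ω (D.X (Fin.last n) ω)} := by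
  have hw : ∀ᵐ ω ∂μ, ∀ i ∈ D.I₂, D.w i ω = D.weightFn μ (D.Z i.castSucc ω) := by
    rw [ae_all_iff]
    intro i
    by_cases hi : i ∈ D.I₂
    · filter_upwards [h.weights i hi, D.trueWeight_ae_eq h.exchangeable i.castSucc] with ω h1 h2 _
      rw [h1, h2, weightFn]
    · exact ae_of_all _ fun ω hi' => absurd hi' hi
  have hpos : ∀ᵐ ω ∂μ, ∀ i, 0 < D.weightFn μ (D.Z i ω) := by
    rw [ae_all_iff]
    intro i
    have hZ : μ.map (D.Z i) = μ.map (D.Z (Fin.last n)) := by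
      have := congrArg Measure.fst (D.map_ZM_eq h.exchangeable i)
      rwa [Measure.fst_map_prodMk (D.measurable_M _),
        Measure.fst_map_prodMk (D.measurable_M _)] at this
    have h1 := D.ae_cleanProb_pos h.absolutelyContinuous
    rw [← hZ] at h1
    filter_upwards [ae_of_ae_map (D.measurable_Z i).aemeasurable h1] with ω hω
    exact div_pos (D.measure_clean_pos h.absolutelyContinuous) hω
  set N := {ω | ¬ ((∀ i ∈ D.I₂, D.w i ω = D.weightFn μ (D.Z i.castSucc ω))
    ∧ ∀ i, 0 < D.weightFn μ (D.Z i ω))} with hN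
  have hN0 : μ N = 0 := ae_iff.1 (hw.and hpos)
  set B₁ := {ω | D.cleanedSamples ω ∈ D.weightedMiss μ (1 - α + β)} with hB₁
  set B₂ := {ω | (1 - β) * ((D.I₂.card : ℝ) + 1) ≤ ∑ _i ∈ D.I₂ with
      D.weightFn μ (D.Z _i.castSucc ω) < D.weightFn μ (D.Z (Fin.last n) ω), (1 : ℝ)} with hB₂
  refine one_sub_le_real_of_compl_subset hα₀.le (B := B₁ ∪ B₂ ∪ N) ?_ fun ω hω => ?_
  · have h1 := D.measure_weightedMiss_le μ h (τ := 1 - α + β) (by linarith)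
    have h2 := D.measure_large_weight_le μ h.exchangeable (τ := 1 - β) (by linarith)
    calc μ (B₁ ∪ B₂ ∪ N) ≤ μ B₁ + μ B₂ + μ N :=
          (measure_union_le _ _).trans (by gcongr; exact measure_union_le _ _)
      _ ≤ ENNReal.ofReal (1 - (1 - α + β)) + ENNReal.ofReal (1 - (1 - β)) + 0 :=
          add_le_add (add_le_add h1 h2) hN0.le
      _ = ENNReal.ofReal α := by
          rw [add_zero, ← ENNReal.ofReal_add (by linarith) (by linarith)]
          congr 1
          ring
  · have hn : ¬ ω ∈ N := fun h => hω (Or.inr h)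
    rw [hN, Set.mem_ofPred_eq, not_not] at hn
    exact D.mem_pcpSet_of_notMem μ hα₁ hβ₀ hβ₁ hn.1 hn.2 (fun h => hω (Or.inl (Or.inl h)))
      (fun h => hω (Or.inl (Or.inr h)))

end Experiment

end TriplyRobust

/-! ### Symmetric shifts of an interval with a peaked density -/

namespace TriplyRobust

section Peaked

lemma setLIntegral_reflect (f : ℝ → ENNReal) (hf : Measurable f) (r d : ℝ) :
    ∫⁻ y in Set.Ico (r - d) r, f y = ∫⁻ y in Set.Ioc r (r + d), f (2 * r - y) := by
  have h := (Measure.measurePreserving_sub_left (volume : Measure ℝ)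
    (2 * r)).setLIntegral_comp_preimage (measurableSet_Ico (a := r - d) (b := r)) hf
  rw [← h]
  congr 2
  ext y
  simp only [Set.mem_preimage, Set.mem_Ico, Set.mem_Ioc]
  constructor <;> rintro ⟨h1, h2⟩ <;> constructor <;> linarith

variable {f : ℝ → ENNReal} {ν : Measure ℝ} [IsFiniteMeasure ν]

lemma real_Ioc_le_of_right_le (hf : Measurable f) (hν : ν = volume.withDensity f) {r : ℝ}
    (h : ∀ v : ℝ, 0 < v → f (r + v) ≤ f (r - v)) (d : ℝ) :
    ν.real (Set.Ioc r (r + d)) ≤ ν.real (Set.Ico (r - d) r) := by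
  refine ENNReal.toReal_mono (measure_ne_top _ _) ?_
  rw [hν, withDensity_apply _ measurableSet_Ioc, withDensity_apply _ measurableSet_Ico,
    setLIntegral_reflect f hf]
  refine setLIntegral_mono (by fun_prop) fun y hy => ?_
  have := h (y - r) (by linarith [hy.1])
  rwa [show r + (y - r) = y by ring, show r - (y - r) = 2 * r - y by ring] at this

lemma real_Ico_le_of_left_le (hf : Measurable f) (hν : ν = volume.withDensity f) {r : ℝ}
    (h : ∀ v : ℝ, 0 < v → f (r - v) ≤ f (r + v)) (d : ℝ) :
    ν.real (Set.Ico (r - d) r) ≤ ν.real (Set.Ioc r (r + d)) := by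
  refine ENNReal.toReal_mono (measure_ne_top _ _) ?_
  rw [hν, withDensity_apply _ measurableSet_Ioc, withDensity_apply _ measurableSet_Ico,
    setLIntegral_reflect f hf]
  refine setLIntegral_mono (by fun_prop) fun y hy => ?_
  have := h (y - r) (by linarith [hy.1])
  rwa [show r + (y - r) = y by ring, show r - (y - r) = 2 * r - y by ring] at this

lemma real_Iic_sub (ν : Measure ℝ) [IsFiniteMeasure ν] {x y : ℝ} (h : x ≤ y) :
    ν.real (Set.Iic y) - ν.real (Set.Iic x) = ν.real (Set.Ioc x y) := by
  rw [← measureReal_sdiff (Set.Iic_subset_Iic.2 h) measurableSet_Iic, Set.Iic_sdiff_Iic]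

/-- Midpoint concavity of the distribution function at an upper endpoint: reflecting in `r` shows
that the step to the right gains no more than the step to the left loses. -/
lemma real_Iic_add_real_Iic_le (hf : Measurable f) (hν : ν = volume.withDensity f) {r : ℝ}
    (h : ∀ v : ℝ, 0 < v → f (r + v) ≤ f (r - v)) {d : ℝ} (hd : 0 ≤ d) :
    ν.real (Set.Iic (r + d)) + ν.real (Set.Iic (r - d)) ≤ 2 * ν.real (Set.Iic r) := by
  have : NullSingletonClass ν := by rw [hν]; infer_instance
  have h1 := real_Ioc_le_of_right_le hf hν h d
  rw [measureReal_congr (Ico_ae_eq_Ioc (μ := ν)), ← real_Iic_sub ν (by linarith),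
    ← real_Iic_sub ν (by linarith)] at h1
  linarith

/-- The mirror image: midpoint convexity at a lower endpoint. -/
lemma two_mul_real_Iic_le (hf : Measurable f) (hν : ν = volume.withDensity f) {r : ℝ}
    (h : ∀ v : ℝ, 0 < v → f (r - v) ≤ f (r + v)) {d : ℝ} (hd : 0 ≤ d) :
    2 * ν.real (Set.Iic r) ≤ ν.real (Set.Iic (r + d)) + ν.real (Set.Iic (r - d)) := by
  have : NullSingletonClass ν := by rw [hν]; infer_instance
  have h1 := real_Ico_le_of_left_le hf hν h d
  rw [measureReal_congr (Ico_ae_eq_Ioc (μ := ν)), ← real_Iic_sub ν (by linarith),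
    ← real_Iic_sub ν (by linarith)] at h1
  linarith

lemma real_shift_upper (hf : Measurable f) (hν : ν = volume.withDensity f) {b : EReal}
    (h : ∀ r : ℝ, b = (r : EReal) → ∀ v : ℝ, 0 < v → f (r + v) ≤ f (r - v)) {d : ℝ} (hd : 0 ≤ d) :
    ν.real {y | ((y + d : ℝ) : EReal) ≤ b} + ν.real {y | ((y - d : ℝ) : EReal) ≤ b}
      ≤ 2 * ν.real {y | (y : EReal) ≤ b} := by
  induction b with
  | bot => simp only [le_bot_iff, EReal.coe_ne_bot, Set.ofPred_false, measureReal_empty]; simp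
  | top => simp only [le_top, Set.ofPred_true]; linarith
  | coe r =>
    have := real_Iic_add_real_Iic_le hf hν (h r rfl) hd
    simp only [EReal.coe_le_coe_iff]
    have e1 : {y : ℝ | y + d ≤ r} = Set.Iic (r - d) := by
      ext y; simp only [Set.mem_ofPred_eq, Set.mem_Iic]; constructor <;> intro h <;> linarith
    have e2 : {y : ℝ | y - d ≤ r} = Set.Iic (r + d) := by
      ext y; simp only [Set.mem_ofPred_eq, Set.mem_Iic]; constructor <;> intro h <;> linarith
    rw [e1, e2]
    change _ ≤ 2 * ν.real (Set.Iic r)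
    linarith

lemma real_shift_lower (hf : Measurable f) (hν : ν = volume.withDensity f) {a : EReal}
    (h : ∀ r : ℝ, a = (r : EReal) → ∀ v : ℝ, 0 < v → f (r - v) ≤ f (r + v)) {d : ℝ} (hd : 0 ≤ d) :
    2 * ν.real {y | (y : EReal) < a}
      ≤ ν.real {y | ((y + d : ℝ) : EReal) < a} + ν.real {y | ((y - d : ℝ) : EReal) < a} := by
  induction a with
  | bot => simp only [not_lt_bot, Set.ofPred_false, measureReal_empty]; simp
  | top => simp only [EReal.coe_lt_top, Set.ofPred_true]; linarith
  | coe r =>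
    have : NullSingletonClass ν := by rw [hν]; infer_instance
    have := two_mul_real_Iic_le hf hν (h r rfl) hd
    simp only [EReal.coe_lt_coe_iff]
    have e1 : {y : ℝ | y + d < r} = Set.Iio (r - d) := by
      ext y; simp only [Set.mem_ofPred_eq, Set.mem_Iio]; constructor <;> intro h <;> linarith
    have e2 : {y : ℝ | y - d < r} = Set.Iio (r + d) := by
      ext y; simp only [Set.mem_ofPred_eq, Set.mem_Iio]; constructor <;> intro h <;> linarith
    rw [e1, e2]
    change 2 * ν.real (Set.Iio r) ≤ _
    rw [measureReal_congr (Iio_ae_eq_Iic (μ := ν) (a := r)),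
      measureReal_congr (Iio_ae_eq_Iic (μ := ν) (a := r - d)),
      measureReal_congr (Iio_ae_eq_Iic (μ := ν) (a := r + d))]
    linarith

/-- For `a ≤ b` the mass of the interval is the mass up to `b` minus the mass below `a`; concavity
at `b` and convexity at `a` add up. For `b < a` all the sets are empty. -/
lemma PeakedInside.real_shift_le {a b : EReal} (h : PeakedInside f a b) (hf : Measurable f)
    (hν : ν = volume.withDensity f) {d : ℝ} (hd : 0 ≤ d) :
    ν.real {y | a ≤ ((y + d : ℝ) : EReal) ∧ ((y + d : ℝ) : EReal) ≤ b}
      + ν.real {y | a ≤ ((y - d : ℝ) : EReal) ∧ ((y - d : ℝ) : EReal) ≤ b}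
      ≤ 2 * ν.real {y | a ≤ (y : EReal) ∧ (y : EReal) ≤ b} := by
  rcases lt_or_ge b a with hba | hab
  · have h0 : ∀ g : ℝ → ℝ, {y | a ≤ ((g y : ℝ) : EReal) ∧ ((g y : ℝ) : EReal) ≤ b} = ∅ := by
      intro g
      ext y
      simp only [Set.mem_ofPred_eq, Set.mem_empty_iff_false, iff_false, not_and, not_le]
      exact fun h => hba.trans_le h
    rw [h0 fun y => y + d, h0 fun y => y - d, h0 fun y => y]
    simp
  · have hdiff : ∀ g : ℝ → ℝ, Measurable g →
        ν.real {y | a ≤ ((g y : ℝ) : EReal) ∧ ((g y : ℝ) : EReal) ≤ b}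
        = ν.real {y | ((g y : ℝ) : EReal) ≤ b} - ν.real {y | ((g y : ℝ) : EReal) < a} := by
      intro g hg
      rw [← measureReal_sdiff]
      · congr 1
        ext y
        simp only [Set.mem_ofPred_eq, Set.mem_sdiff, not_lt]
        exact and_comm
      · exact fun y hy => (le_of_lt hy).trans hab
      · exact measurableSet_lt (measurable_coe_real_ereal.comp hg) measurable_const
    rw [hdiff (fun y => y + d) (by fun_prop), hdiff (fun y => y - d) (by fun_prop),
      hdiff (fun y => y) (by fun_prop)]
    have h1 := real_shift_upper hf hν h.1 hd
    have h2 := real_shift_lower hf hν h.2 hd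
    linarith

/-- Moving an interval inside which the density is peaked by `d` to the left or to the right, with
equal chances, does not increase its mass. -/
theorem PeakedInside.measure_shift_le {a b : EReal} (h : PeakedInside f a b) (hf : Measurable f)
    (hν : ν = volume.withDensity f) (d : ℝ) :
    ν {y | a ≤ ((y + d : ℝ) : EReal) ∧ ((y + d : ℝ) : EReal) ≤ b}
      + ν {y | a ≤ ((y - d : ℝ) : EReal) ∧ ((y - d : ℝ) : EReal) ≤ b}
      ≤ 2 * ν {y | a ≤ (y : EReal) ∧ (y : EReal) ≤ b} := by
  have key : ∀ d : ℝ, 0 ≤ d → ν {y | a ≤ ((y + d : ℝ) : EReal) ∧ ((y + d : ℝ) : EReal) ≤ b}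
      + ν {y | a ≤ ((y - d : ℝ) : EReal) ∧ ((y - d : ℝ) : EReal) ≤ b}
      ≤ 2 * ν {y | a ≤ (y : EReal) ∧ (y : EReal) ≤ b} := by
    intro d hd
    rw [← ENNReal.toReal_le_toReal (by finiteness) (by finiteness),
      ENNReal.toReal_add (measure_ne_top _ _) (measure_ne_top _ _), ENNReal.toReal_mul]
    exact h.real_shift_le hf hν hd
  rcases le_total 0 d with hd | hd
  · exact key d hd
  · have := key (-d) (by linarith)
    simp only [sub_neg_eq_add, ← sub_eq_add_neg] at this
    rwa [add_comm]

end Peaked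

/-! ### Products of kernels and independence -/

section Kernels

variable {Ω β γ δ : Type*} [MeasurableSpace Ω] [MeasurableSpace β] [MeasurableSpace γ]
  [MeasurableSpace δ]

lemma measurable_lintegral_kernel_comp (κ : Kernel β δ) [IsSFiniteKernel κ] {φ : γ → β}
    (hφ : Measurable φ) {F : γ → δ → ENNReal} (hF : Measurable (Function.uncurry F)) :
    Measurable fun p => ∫⁻ b, F p b ∂(κ (φ p)) :=
  Measurable.lintegral_kernel_prod_right (κ := κ.comap φ hφ) hF

/-- The product of finitely many Markov kernels from the same space. -/
def piKernel {ι : Type*} [Fintype ι] (κ : ι → Kernel β δ) [∀ i, IsMarkovKernel (κ i)] :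
    Kernel β (ι → δ) where
  toFun b := Measure.pi fun i => κ i b
  measurable' := by
    refine Measurable.measure_of_isPiSystem_of_isProbabilityMeasure generateFrom_pi.symm
      isPiSystem_pi ?_
    rintro _ ⟨t, ht, rfl⟩
    simp only [Measure.pi_pi]
    exact Finset.measurable_prod _ fun i _ => Kernel.measurable_coe _ (ht i (Set.mem_univ i))

lemma piKernel_apply {ι : Type*} [Fintype ι] (κ : ι → Kernel β δ) [∀ i, IsMarkovKernel (κ i)]
    (b : β) : piKernel κ b = Measure.pi fun i => κ i b := rfl

instance {ι : Type*} [Fintype ι] (κ : ι → Kernel β δ) [∀ i, IsMarkovKernel (κ i)] :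
    IsMarkovKernel (piKernel κ) :=
  ⟨fun b => by rw [piKernel_apply]; infer_instance⟩

/-- Injectivity covers both needs: permuting the coordinates of a product and keeping only some of
them. -/
lemma pi_map_comp_injective {ι ι' : Type*} [Fintype ι] [Fintype ι'] (m : ι → Measure δ)
    [∀ i, IsProbabilityMeasure (m i)] {g : ι' → ι} (hg : Function.Injective g) :
    (Measure.pi m).map (fun e i => e (g i)) = Measure.pi fun i => m (g i) := by
  have h1 : iIndepFun (fun (i : ι) (e : ι → δ) => e i) (Measure.pi m) :=
    iIndepFun_pi (X := fun i => (id : δ → δ)) fun i => aemeasurable_id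
  have h2 := (iIndepFun_iff_map_fun_eq_pi_map (fun i => (measurable_pi_apply _).aemeasurable)).1
    (h1.precomp hg)
  rw [h2]
  congr 1
  funext i
  exact (measurePreserving_eval m (g i)).map_eq

/-- If `V` is drawn from a kernel applied to `W`, independently of `C`, and `W` is independent of
`C`, then `(W, V)` is independent of `C`. -/
lemma indepFun_prodMk_of_map_eq_compProd {μ : Measure Ω} [IsProbabilityMeasure μ] {W : Ω → β}
    {V : Ω → δ} {C : Ω → γ} (hW : Measurable W) (hV : Measurable V) (hC : Measurable C)
    {κ : Kernel β δ} [IsMarkovKernel κ]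
    (h : ∀ F : (β × γ) × δ → ENNReal, Measurable F →
      ∫⁻ ω, F ((W ω, C ω), V ω) ∂μ = ∫⁻ ω, ∫⁻ v, F ((W ω, C ω), v) ∂(κ (W ω)) ∂μ)
    (hWC : IndepFun W C μ) : IndepFun (fun ω => (W ω, V ω)) C μ := by
  rw [indepFun_iff_measure_inter_preimage_eq_mul]
  intro s t hs ht
  -- The first factor does not depend on `t'`, so the case `t' = univ` identifies it with the
  -- probability that `(W, V)` lies in `s`.
  have hrep : ∀ t' : Set γ, MeasurableSet t' → μ ((fun ω => (W ω, V ω)) ⁻¹' s ∩ C ⁻¹' t')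
      = (∫⁻ ω, κ (W ω) (Prod.mk (W ω) ⁻¹' s) ∂μ) * μ (C ⁻¹' t') := by
    intro t' ht'
    have hm : MeasurableSet ((fun ω => (W ω, V ω)) ⁻¹' s ∩ C ⁻¹' t') :=
      (hs.preimage (hW.prodMk hV)).inter (hC ht')
    have hK : Measurable fun b => κ b (Prod.mk b ⁻¹' s) := Kernel.measurable_kernel_prodMk_left hs
    have hsm : Measurable (s.indicator fun _ => (1 : ENNReal)) := measurable_const.indicator hs
    have htm : Measurable (t'.indicator fun _ => (1 : ENNReal)) := measurable_const.indicator ht'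
    have h1 := h (fun q => s.indicator (fun _ => 1) (q.1.1, q.2) * t'.indicator (fun _ => 1) q.1.2)
      (by fun_prop)
    have e1 : ∫⁻ ω, s.indicator (fun _ => (1 : ENNReal)) (W ω, V ω)
        * t'.indicator (fun _ => 1) (C ω) ∂μ = μ ((fun ω => (W ω, V ω)) ⁻¹' s ∩ C ⁻¹' t') := by
      rw [← lintegral_indicator_one hm]
      refine lintegral_congr fun ω => ?_
      by_cases ha : (W ω, V ω) ∈ s <;> by_cases hb : C ω ∈ t' <;> simp [ha, hb]
    have e2 : ∀ ω, ∫⁻ v, s.indicator (fun _ => (1 : ENNReal)) (W ω, v)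
        * t'.indicator (fun _ => 1) (C ω) ∂(κ (W ω))
        = κ (W ω) (Prod.mk (W ω) ⁻¹' s) * t'.indicator (fun _ => 1) (C ω) := by
      intro ω
      rw [lintegral_mul_const _ (by fun_prop),
        ← lintegral_indicator_one (measurable_prodMk_left hs)]
      rfl
    rw [← e1, h1, lintegral_congr e2]
    have h2 := lintegral_mul_eq_lintegral_mul_lintegral_of_indepFun (μ := μ)
      (f := fun ω => κ (W ω) (Prod.mk (W ω) ⁻¹' s)) (g := fun ω => t'.indicator (fun _ => 1) (C ω))
      (hK.comp hW) (htm.comp hC) (hWC.comp hK htm)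
    simp only [Pi.mul_apply] at h2
    rw [h2, ← lintegral_indicator_one (hC ht')]
    rfl
  have h1 := hrep Set.univ MeasurableSet.univ
  rw [Set.preimage_univ, Set.inter_univ, measure_univ, mul_one] at h1
  rw [hrep t ht, h1]

/-- If `C` is independent of `(W, V)`, then the conditional law of `V` given `W` is also that given
`(W, C)`. -/
lemma lintegral_of_indepFun_of_map_eq_compProd {μ : Measure Ω} [IsProbabilityMeasure μ] {W : Ω → β}
    {V : Ω → δ} {C : Ω → γ} (hW : Measurable W) (hV : Measurable V) (hC : Measurable C)
    {κ : Kernel β δ} [IsMarkovKernel κ]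
    (h : μ.map (fun ω => (W ω, V ω)) = μ.map W ⊗ₘ κ)
    (hind : IndepFun C (fun ω => (W ω, V ω)) μ) {F : (β × γ) × δ → ENNReal} (hF : Measurable F) :
    ∫⁻ ω, F ((W ω, C ω), V ω) ∂μ = ∫⁻ ω, ∫⁻ v, F ((W ω, C ω), v) ∂(κ (W ω)) ∂μ := by
  have hind' : IndepFun C W μ := hind.comp measurable_id measurable_fst
  have h1 := (indepFun_iff_map_prod_eq_prod_map_map hC.aemeasurable
    (hW.prodMk hV).aemeasurable).1 hind
  have h2 := (indepFun_iff_map_prod_eq_prod_map_map hC.aemeasurable hW.aemeasurable).1 hind'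
  have hF' : Measurable fun q : γ × (β × δ) => F ((q.2.1, q.1), q.2.2) := by fun_prop
  have hG : Measurable fun q : γ × β => ∫⁻ v, F ((q.2, q.1), v) ∂(κ q.2) :=
    measurable_lintegral_kernel_comp κ measurable_snd (by fun_prop)
  calc ∫⁻ ω, F ((W ω, C ω), V ω) ∂μ
      = ∫⁻ q, F ((q.2.1, q.1), q.2.2) ∂(μ.map fun ω => (C ω, (W ω, V ω))) := by
        rw [lintegral_map hF' (hC.prodMk (hW.prodMk hV))]
    _ = ∫⁻ q, (∫⁻ v, F ((q.2, q.1), v) ∂(κ q.2)) ∂(μ.map fun ω => (C ω, W ω)) := by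
        rw [h1, h2, h, lintegral_prod _ hF'.aemeasurable, lintegral_prod _ hG.aemeasurable]
        refine lintegral_congr fun c => ?_
        rw [Measure.lintegral_compProd (by fun_prop)]
    _ = ∫⁻ ω, ∫⁻ v, F ((W ω, C ω), v) ∂(κ (W ω)) ∂μ := by
        rw [lintegral_map hG (hC.prodMk hW)]

end Kernels

end TriplyRobust

namespace TriplyRobust

section Kernels

variable {Ω β γ δ : Type*} [MeasurableSpace Ω] [MeasurableSpace β] [MeasurableSpace γ]
  [MeasurableSpace δ]

lemma map_eq_compProd_of_lintegral {μ : Measure Ω} [SFinite μ] {W : Ω → β} {V : Ω → δ}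
    (hW : Measurable W) (hV : Measurable V) {κ : Kernel β δ} [IsSFiniteKernel κ]
    (h : ∀ F : β × δ → ENNReal, Measurable F →
      ∫⁻ ω, F (W ω, V ω) ∂μ = ∫⁻ ω, ∫⁻ v, F (W ω, v) ∂(κ (W ω)) ∂μ) :
    μ.map (fun ω => (W ω, V ω)) = μ.map W ⊗ₘ κ := by
  refine Measure.ext_of_lintegral _ fun F hF => ?_
  rw [lintegral_map hF (hW.prodMk hV), h F hF, Measure.lintegral_compProd hF,
    lintegral_map hF.lintegral_kernel_prod_right' hW]

/-- For independent `C` and `P`, an inequality between functions of `(C, P)` may be checked by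
fixing the value of `C` first. -/
lemma lintegral_mono_of_indepFun {μ : Measure Ω} [IsProbabilityMeasure μ] {C : Ω → γ} {P : Ω → β}
    (hC : Measurable C) (hP : Measurable P) (hind : IndepFun C P μ) {F G : γ × β → ENNReal}
    (hF : Measurable F) (hG : Measurable G)
    (h : ∀ᵐ ω ∂μ, ∀ᵐ p ∂(μ.map P), F (C ω, p) ≤ G (C ω, p)) :
    ∫⁻ ω, F (C ω, P ω) ∂μ ≤ ∫⁻ ω, G (C ω, P ω) ∂μ := by
  have h1 := (indepFun_iff_map_prod_eq_prod_map_map hC.aemeasurable hP.aemeasurable).1 hind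
  have hrep : ∀ H : γ × β → ENNReal, Measurable H →
      ∫⁻ ω, H (C ω, P ω) ∂μ = ∫⁻ ω, ∫⁻ p, H (C ω, p) ∂(μ.map P) ∂μ := by
    intro H hH
    rw [← lintegral_map (μ := μ) hH (hC.prodMk hP), h1, lintegral_prod _ hH.aemeasurable,
      lintegral_map hH.lintegral_prod_right' hC]
  rw [hrep F hF, hrep G hG]
  refine lintegral_mono_ae ?_
  filter_upwards [h] with ω hω using lintegral_mono_ae hω

end Kernels

/-! ### UI as a function of training data and imputed scores -/

namespace Experiment

variable {Ω 𝒳 𝒵 𝓕 : Type*} [MeasurableSpace Ω] [MeasurableSpace 𝒳] [MeasurableSpace 𝒵] {n : ℕ}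

/-- The space of the data on which the models are fitted. -/
abbrev TrainSpace (D : Experiment Ω 𝒳 𝒵 𝓕 n) := D.I₁ → 𝒳 × ℝ × 𝒵 × Fin 2

/-- The space of the training data together with the imputed calibration scores. -/
abbrev CalSpace (D : Experiment Ω 𝒳 𝒵 𝓕 n) := D.TrainSpace × (D.J₂ → ℝ)

/-- The score of the imputed label of the sample point `s`, for the models fitted on `t` and the
imputation error `e`. -/
def impScore (D : Experiment Ω 𝒳 𝒵 𝓕 n) (t : D.TrainSpace) (s : 𝒳 × ℝ × ℝ × 𝒵 × Fin 2)
    (e : ℝ) : ℝ :=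
  D.score s.1 (if s.2.2.2.2 = 0 then s.2.2.1 else D.ghat t s.1 s.2.2.2.1 + e) (D.fhat t)

lemma measurable_impScore (D : Experiment Ω 𝒳 𝒵 𝓕 n) {A : Type*} [MeasurableSpace A]
    {t : A → D.TrainSpace} {s : A → 𝒳 × ℝ × ℝ × 𝒵 × Fin 2} {e : A → ℝ}
    (ht : Measurable t) (hs : Measurable s) (he : Measurable e) :
    Measurable fun p => D.impScore (t p) (s p) (e p) := by
  have hg : Measurable fun p => D.ghat (t p) (s p).1 (s p).2.2.2.1 :=
    D.measurable_ghat.comp (ht.prodMk ((by fun_prop : Measurable fun p => (s p).1).prodMk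
      (by fun_prop : Measurable fun p => (s p).2.2.2.1)))
  refine D.measurable_score.comp (ht.prodMk (Measurable.prodMk (by fun_prop) ?_))
  refine Measurable.ite ?_ (by fun_prop) (by fun_prop)
  exact (by fun_prop : Measurable fun p => (s p).2.2.2.2) (measurableSet_singleton 0)

/-- The training data and the imputed calibration scores. -/
def calInfo (D : Experiment Ω 𝒳 𝒵 𝓕 n) (ω : Ω) : D.CalSpace :=
  (D.trainData ω, fun i => D.imputedScore i.1 ω)

lemma measurable_calInfo (D : Experiment Ω 𝒳 𝒵 𝓕 n) : Measurable D.calInfo :=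
  D.measurable_trainData.prodMk (measurable_pi_lambda _ fun _ =>
    D.measurable_impScore D.measurable_trainData (D.measurable_sample _) (D.measurable_e _))

/-- The score `t` does not exceed the UI threshold from the imputed calibration scores `s`. -/
def Covers (D : Experiment Ω 𝒳 𝒵 𝓕 n) (α : ℝ) (s : D.J₂ → ℝ) (t : ℝ) : Prop :=
  ∑ _i with s _i < t, (1 : ℝ) < (1 - α) * ((D.J₂.card : ℝ) + 1)

lemma measurableSet_covers (D : Experiment Ω 𝒳 𝒵 𝓕 n) (α : ℝ) {A : Type*} [MeasurableSpace A]
    {s : A → D.J₂ → ℝ} {t : A → ℝ} (hs : Measurable s) (ht : Measurable t) :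
    MeasurableSet {p | D.Covers α (s p) (t p)} := by
  simp only [Covers, Finset.sum_filter]
  refine measurableSet_lt (Finset.measurable_sum _ fun j _ => ?_) measurable_const
  exact Measurable.ite (measurableSet_lt (by fun_prop) ht) measurable_const measurable_const

/-- The indicator function of the UI prediction set. -/
def uiInd (D : Experiment Ω 𝒳 𝒵 𝓕 n) (α : ℝ) (c : D.CalSpace) (x : 𝒳) (y : ℝ) : ENNReal :=
  Set.indicator {y | D.Covers α c.2 (D.score x y (D.fhat c.1))} (fun _ => 1) y

lemma measurable_uiInd (D : Experiment Ω 𝒳 𝒵 𝓕 n) (α : ℝ) {A : Type*} [MeasurableSpace A]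
    {c : A → D.CalSpace} {x : A → 𝒳} {y : A → ℝ} (hc : Measurable c) (hx : Measurable x)
    (hy : Measurable y) : Measurable fun p => D.uiInd α (c p) (x p) (y p) := by
  have hs : Measurable fun p => D.score (x p) (y p) (D.fhat (c p).1) :=
    D.measurable_score.comp ((measurable_fst.comp hc).prodMk (hx.prodMk hy))
  exact Measurable.ite (D.measurableSet_covers α (measurable_snd.comp hc) hs) measurable_const
    measurable_const

lemma mem_uiSet_iff (D : Experiment Ω 𝒳 𝒵 𝓕 n) {α : ℝ} (hα : α < 1) (ω : Ω) (x : 𝒳) (y : ℝ) :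
    y ∈ D.uiSet α ω x ↔ D.Covers α (D.calInfo ω).2 (D.score x y (D.fhat (D.calInfo ω).1)) := by
  change (D.score x y (D.fhat (D.trainData ω)) : EReal) ≤ augmentedQuantile (1 - α) D.J₂
    (fun i => (D.imputedScore i ω : EReal)) ↔ _
  rw [le_augmentedQuantile_iff (by linarith), Covers, Finset.sum_filter, Finset.sum_filter,
    ← Finset.sum_attach D.J₂]
  simp only [EReal.coe_lt_coe_iff, calInfo, Finset.univ_eq_attach]
  congr!

lemma uiInd_eq_indicator (D : Experiment Ω 𝒳 𝒵 𝓕 n) {α : ℝ} (hα : α < 1) (ω : Ω) (x : 𝒳) (y : ℝ) :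
    D.uiInd α (D.calInfo ω) x y = (D.uiSet α ω x).indicator (fun _ => 1) y := by
  rw [uiInd]
  congr 1
  ext y
  exact (D.mem_uiSet_iff hα ω x y).symm

/-- The training data as a function of the `n` training points. -/
def trainOf (D : Experiment Ω 𝒳 𝒵 𝓕 n) (w : Fin n → 𝒳 × ℝ × ℝ × 𝒵 × Fin 2) : D.TrainSpace :=
  fun i => ((w i.1).1, (w i.1).2.2.1, (w i.1).2.2.2.1, (w i.1).2.2.2.2)

lemma measurable_trainOf (D : Experiment Ω 𝒳 𝒵 𝓕 n) : Measurable D.trainOf := by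
  refine measurable_pi_lambda _ fun i => ?_
  unfold trainOf
  fun_prop

/-- The UI errors. -/
def calErrors (D : Experiment Ω 𝒳 𝒵 𝓕 n) (ω : Ω) (i : D.J₂) : ℝ := D.e i.1 ω

lemma measurable_calErrors (D : Experiment Ω 𝒳 𝒵 𝓕 n) : Measurable D.calErrors :=
  measurable_pi_lambda _ fun _ => D.measurable_e _

/-! ### Imputed scores are exchangeable -/

section Imputation

variable (D : Experiment Ω 𝒳 𝒵 𝓕 n) (μ : Measure Ω) [IsProbabilityMeasure μ]

instance : IsMarkovKernel (D.errorLaw μ) := by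
  unfold errorLaw
  infer_instance

/-- The law of an imputation error for the `j`-th point in a vector of sample points. -/
def vecErrorLaw (j : Fin (n + 1)) : Kernel (Fin (n + 1) → 𝒳 × ℝ × ℝ × 𝒵 × Fin 2) ℝ :=
  (D.errorLaw μ).comap (fun v => (D.vecTrain v, (v j).2.2.2.1))
    (D.measurable_vecTrain.prodMk (by fun_prop))

instance (j : Fin (n + 1)) : IsMarkovKernel (D.vecErrorLaw μ j) := by
  unfold vecErrorLaw
  infer_instance

/-- The joint law of the sample points and of imputation errors for all of them. -/
def sampleErrorLaw : Measure (Fin (n + 1) → (𝒳 × ℝ × ℝ × 𝒵 × Fin 2) × ℝ) :=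
  ((μ.map fun ω j => D.sample j ω) ⊗ₘ piKernel (D.vecErrorLaw μ)).map
    fun p j => (p.1 j, p.2 j)

lemma measurable_zip : Measurable fun (p : (Fin (n + 1) → 𝒳 × ℝ × ℝ × 𝒵 × Fin 2)
    × (Fin (n + 1) → ℝ)) j => (p.1 j, p.2 j) := by
  fun_prop

lemma lintegral_sampleErrorLaw {F : (Fin (n + 1) → (𝒳 × ℝ × ℝ × 𝒵 × Fin 2) × ℝ) → ENNReal}
    (hF : Measurable F) :
    ∫⁻ q, F q ∂(D.sampleErrorLaw μ) = ∫⁻ v, ∫⁻ e, F (fun j => (v j, e j))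
      ∂(piKernel (D.vecErrorLaw μ) v) ∂(μ.map fun ω j => D.sample j ω) := by
  have hFz : Measurable fun (p : (Fin (n + 1) → 𝒳 × ℝ × ℝ × 𝒵 × Fin 2) × (Fin (n + 1) → ℝ)) =>
    F (fun j => (p.1 j, p.2 j)) := hF.comp measurable_zip
  rw [sampleErrorLaw, lintegral_map hF measurable_zip, Measure.lintegral_compProd hFz]

instance : IsProbabilityMeasure (D.sampleErrorLaw μ) := by
  have : IsProbabilityMeasure (μ.map fun ω j => D.sample j ω) :=
    Measure.isProbabilityMeasure_map D.measurable_samples.aemeasurable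
  exact Measure.isProbabilityMeasure_map measurable_zip.aemeasurable

/-- The law of the error of a point depends on that point's `Z` and on the training data, which the
transposition fixes. So permuting the points permutes the error laws in the same way. -/
lemma sampleErrorLaw_comp_swap (hexch : Exchangeable μ D.sample) {i : Fin (n + 1)}
    (hi : i ∈ withTest D.J₂) :
    (D.sampleErrorLaw μ).map (fun q => q ∘ Equiv.swap (Fin.last n) i) = D.sampleErrorLaw μ := by
  set σ := Equiv.swap (Fin.last n) i with hσ
  have hq : Measurable fun q : Fin (n + 1) → (𝒳 × ℝ × ℝ × 𝒵 × Fin 2) × ℝ => q ∘ σ :=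
    measurable_pi_lambda _ fun j => measurable_pi_apply _
  have hv : Measurable fun v : Fin (n + 1) → 𝒳 × ℝ × ℝ × 𝒵 × Fin 2 => v ∘ σ :=
    measurable_pi_lambda _ fun j => measurable_pi_apply _
  have he : Measurable fun e : Fin (n + 1) → ℝ => e ∘ σ :=
    measurable_pi_lambda _ fun j => measurable_pi_apply _
  refine Measure.ext_of_lintegral _ fun F hF => ?_
  have hFz : Measurable fun (p : (Fin (n + 1) → 𝒳 × ℝ × ℝ × 𝒵 × Fin 2) × (Fin (n + 1) → ℝ)) =>
    F (fun j => (p.1 j, p.2 j)) := hF.comp measurable_zip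
  have hFq : Measurable fun q : Fin (n + 1) → (𝒳 × ℝ × ℝ × 𝒵 × Fin 2) × ℝ => F (q ∘ σ) := hF.comp hq
  rw [lintegral_map hF hq, D.lintegral_sampleErrorLaw μ hFq,
    D.lintegral_sampleErrorLaw μ hF]
  conv_rhs => rw [← D.map_samples_comp_swap hexch (Fin.last n) i]
  rw [lintegral_map hFz.lintegral_kernel_prod_right' hv]
  refine lintegral_congr fun v => ?_
  have h1 : piKernel (D.vecErrorLaw μ) (v ∘ σ) = (piKernel (D.vecErrorLaw μ) v).map
      fun e => e ∘ σ := by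
    rw [piKernel_apply, piKernel_apply]
    have h2 := pi_map_comp_injective (fun j => D.vecErrorLaw μ j v) σ.injective
    refine Eq.trans ?_ h2.symm
    congr 1
    funext j
    simp only [vecErrorLaw, Kernel.comap_apply, hσ, D.vecTrain_comp_swap D.disjoint_I₁_J₂ hi,
      Function.comp]
  have hFv : Measurable fun e : Fin (n + 1) → ℝ => F fun j => ((v ∘ σ) j, e j) :=
    hFz.comp measurable_prodMk_left
  rw [h1]
  exact (lintegral_map hFv he).symm

/-- Restricting a product measure to the calibration indices and to the test index. -/
lemma pi_map_calibration_test (m : Fin (n + 1) → Measure ℝ) [∀ i, IsProbabilityMeasure (m i)] :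
    (Measure.pi m).map (fun e => (fun i : D.J₂ => e i.1.castSucc, e (Fin.last n)))
      = (Measure.pi fun i : D.J₂ => m i.1.castSucc).prod (m (Fin.last n)) := by
  -- Indexing by `Option` lets one injective reindexing do the restriction before the test
  -- coordinate is split off.
  set g : Option D.J₂ → Fin (n + 1) := fun o => o.elim (Fin.last n) fun i => i.1.castSucc with hg
  have hinj : Function.Injective g := by
    rintro (_ | i) (_ | j) h
    · rfl
    · exact absurd h.symm (Fin.castSucc_ne_last _)
    · exact absurd h (Fin.castSucc_ne_last _)
    · exact congrArg some (Subtype.ext (Fin.castSucc_injective n h))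
  have h1 := pi_map_comp_injective m hinj
  rw [← Measure.pi_map_piOptionEquivProd (fun o => m (g o))] at h1
  have h2 := congrArg (fun ν => ν.map (MeasurableEquiv.piOptionEquivProd fun _ : Option D.J₂ => ℝ)) h1
  beta_reduce at h2
  rw [Measure.map_map (MeasurableEquiv.measurable _) (by fun_prop),
    Measure.map_map (MeasurableEquiv.measurable _) (MeasurableEquiv.measurable _),
    MeasurableEquiv.self_comp_symm, Measure.map_id] at h2
  exact h2

/-- The vectors of sample points and errors for which the imputed test score is not covered. -/
def uncovered (α : ℝ) : Set ((Fin (n + 1) → 𝒳 × ℝ × ℝ × 𝒵 × Fin 2) × (D.J₂ → ℝ) × ℝ) :=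
  {q | ¬ D.Covers α (fun i => D.impScore (D.vecTrain q.1) (q.1 i.1.castSucc) (q.2.1 i))
    (D.impScore (D.vecTrain q.1) (q.1 (Fin.last n)) q.2.2)}

lemma measurableSet_uncovered (α : ℝ) : MeasurableSet (D.uncovered α) := by
  have hT : Measurable fun q : (Fin (n + 1) → 𝒳 × ℝ × ℝ × 𝒵 × Fin 2) × (D.J₂ → ℝ) × ℝ =>
    D.vecTrain q.1 := D.measurable_vecTrain.comp measurable_fst
  refine (D.measurableSet_covers α (measurable_pi_lambda _ fun i => ?_) ?_).compl
  · exact D.measurable_impScore hT (by fun_prop) (by fun_prop)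
  · exact D.measurable_impScore hT (by fun_prop) (by fun_prop)

/-- Here the test point is treated exactly like a calibration point, with an error and an imputed
label of its own, so the conformal inequality applies. -/
lemma sampleErrorLaw_uncovered_le (hexch : Exchangeable μ D.sample) {α : ℝ} (hα₀ : 0 < α) :
    ∫⁻ v, ∫⁻ e, (D.uncovered α).indicator (fun _ => 1)
        (v, (fun i : D.J₂ => e i.1.castSucc), e (Fin.last n))
      ∂(piKernel (D.vecErrorLaw μ) v) ∂(μ.map fun ω j => D.sample j ω) ≤ ENNReal.ofReal α := by
  set t : (Fin (n + 1) → (𝒳 × ℝ × ℝ × 𝒵 × Fin 2) × ℝ) → Fin (n + 1) → ℝ :=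
    fun q j => D.impScore (D.vecTrain fun l => (q l).1) (q j).1 (q j).2 with ht
  have htm : ∀ j, Measurable fun q => t q j := fun j =>
    D.measurable_impScore (D.measurable_vecTrain.comp (by fun_prop)) (by fun_prop) (by fun_prop)
  have key := measure_large_le (D.sampleErrorLaw μ) (withTest D.J₂) (last_mem_withTest D.J₂)
    (fun i hi => D.sampleErrorLaw_comp_swap μ hexch hi) t htm (fun i hi q j =>
      congrArg (fun T => D.impScore T _ _)
        (D.vecTrain_comp_swap D.disjoint_I₁_J₂ hi (fun l => (q l).1))) (τ := 1 - α) (by linarith)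
  rw [sub_sub_cancel] at key
  set B := {q | (1 - α) * ((withTest D.J₂).card : ℝ)
    ≤ ∑ j ∈ withTest D.J₂ with t q j < t q (Fin.last n), (1 : ℝ)} with hB
  have hBm : MeasurableSet B := by
    simp only [hB, Finset.sum_filter]
    refine measurableSet_le measurable_const (Finset.measurable_sum _ fun j _ => ?_)
    exact Measurable.ite (measurableSet_lt (htm _) (htm _)) measurable_const measurable_const
  rw [← lintegral_indicator_one hBm,
    D.lintegral_sampleErrorLaw μ (measurable_one.indicator hBm)] at key
  refine le_trans (le_of_eq ?_) key
  refine lintegral_congr fun v => lintegral_congr fun e => ?_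
  have hiff : (v, (fun i : D.J₂ => e i.1.castSucc), e (Fin.last n)) ∈ D.uncovered α
      ↔ (fun j => (v j, e j)) ∈ B := by
    simp only [uncovered, Covers, hB, Set.mem_ofPred_eq, not_lt, Finset.sum_filter, sum_withTest,
      card_withTest, lt_irrefl, if_false, zero_add, ht, Nat.cast_add, Nat.cast_one]
    rw [← Finset.sum_attach D.J₂, Finset.univ_eq_attach]
  by_cases h : (fun j => (v j, e j)) ∈ B
  · rw [Set.indicator_of_mem h, Set.indicator_of_mem (hiff.2 h), Pi.one_apply]
  · rw [Set.indicator_of_notMem h, Set.indicator_of_notMem (mt hiff.1 h)]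

end Imputation

end Experiment

end TriplyRobust

namespace TriplyRobust

namespace Experiment

variable {Ω 𝒳 𝒵 𝓕 : Type*} [MeasurableSpace Ω] [StandardBorelSpace Ω] [MeasurableSpace 𝒳]
  [MeasurableSpace 𝒵] {n : ℕ} {D : Experiment Ω 𝒳 𝒵 𝓕 n} {μ : Measure Ω} [IsProbabilityMeasure μ]
  {α : ℝ} {gstar : 𝒳 → 𝒵 → ℝ} {a b : Ω → 𝒳 → EReal} {f : 𝒳 × 𝒵 → ℝ → ENNReal}

namespace UIAssumptionsWith

lemma lintegral_calErrors (h : D.UIAssumptionsWith μ α gstar a b f)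
    {F : (Fin (n + 1) → 𝒳 × ℝ × ℝ × 𝒵 × Fin 2) × (D.J₂ → ℝ) → ENNReal} (hF : Measurable F) :
    ∫⁻ ω, F ((fun j => D.sample j ω), D.calErrors ω) ∂μ
      = ∫⁻ ω, ∫⁻ e, F ((fun j => D.sample j ω), e)
        ∂(Measure.pi fun i : D.J₂ => D.errorLaw μ (D.trainData ω, D.Z i.1.castSucc ω)) ∂μ := by
  rw [lintegral_condDistrib μ D.measurable_samples D.measurable_calErrors hF]
  refine lintegral_congr_ae ?_
  filter_upwards [h.errors] with ω hω
  rw [← hω]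
  rfl

/-- The imputed scores and the training data are independent of the test point. -/
lemma indepFun_calInfo (h : D.UIAssumptionsWith μ α gstar a b f) :
    IndepFun D.calInfo (D.sample (Fin.last n)) μ := by
  set W : Ω → Fin n → 𝒳 × ℝ × ℝ × 𝒵 × Fin 2 := fun ω i => D.sample i.castSucc ω with hW
  have hWm : Measurable W := measurable_pi_lambda _ fun i => D.measurable_sample _
  have hWC : IndepFun W (D.sample (Fin.last n)) μ := by
    have h1 := h.indep.indepFun_finset (Finset.univ.map Fin.castSuccEmb) {Fin.last n} (by
      rw [Finset.disjoint_singleton_right]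
      exact last_notMem_map _) D.measurable_sample
    refine h1.comp (φ := fun v (i : Fin n) => v ⟨i.castSucc, Finset.mem_map.2 ⟨i, by simp, rfl⟩⟩)
      (ψ := fun v => v ⟨Fin.last n, by simp⟩) ?_ ?_
    · exact measurable_pi_lambda _ fun i => measurable_pi_apply _
    · exact measurable_pi_apply _
  -- The calibration errors are drawn from a kernel that sees only the `n` training points, so they
  -- bring in no dependence on the test point.
  set κ : Kernel (Fin n → 𝒳 × ℝ × ℝ × 𝒵 × Fin 2) (D.J₂ → ℝ) := piKernel fun i : D.J₂ =>
    (D.errorLaw μ).comap (fun w => (D.trainOf w, (w i.1).2.2.2.1))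
      (D.measurable_trainOf.prodMk (by fun_prop)) with hκ
  have key := indepFun_prodMk_of_map_eq_compProd (κ := κ) hWm D.measurable_calErrors
    (D.measurable_sample (Fin.last n)) (fun F hF => h.lintegral_calErrors
      (F := fun q => F ((fun i => q.1 i.castSucc, q.1 (Fin.last n)), q.2)) (by fun_prop)) hWC
  refine key.comp (φ := fun q => ((D.trainOf q.1,
    fun i => D.impScore (D.trainOf q.1) (q.1 i.1) (q.2 i)) : D.CalSpace)) ?_ measurable_id
  have hT : Measurable fun q : (Fin n → 𝒳 × ℝ × ℝ × 𝒵 × Fin 2) × (D.J₂ → ℝ) => D.trainOf q.1 :=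
    D.measurable_trainOf.comp measurable_fst
  exact hT.prodMk (measurable_pi_lambda _ fun i =>
    D.measurable_impScore hT (by fun_prop) (by fun_prop))

/-- An imputed test score is covered with probability at least `1 - α`. -/
lemma one_le_imputed_coverage (h : D.UIAssumptionsWith μ α gstar a b f)
    (hexch : Exchangeable μ D.sample) (hα₀ : 0 < α) :
    1 ≤ ∫⁻ ω, ∫⁻ e, {e | D.Covers α (D.calInfo ω).2
        (D.impScore (D.trainData ω) (D.sample (Fin.last n) ω) e)}.indicator (fun _ => 1) e
      ∂(D.errorLaw μ (D.trainData ω, D.Z (Fin.last n) ω)) ∂μ + ENNReal.ofReal α := by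
  have hB := D.measurableSet_uncovered α
  set G : (Fin (n + 1) → 𝒳 × ℝ × ℝ × 𝒵 × Fin 2) × (D.J₂ → ℝ) × ℝ → ENNReal :=
    (D.uncovered α).indicator fun _ => 1 with hG
  have hGm : Measurable G := measurable_const.indicator hB
  have hle : ∫⁻ ω, ∫⁻ e, G ((fun j => D.sample j ω), D.calErrors ω, e)
      ∂(D.errorLaw μ (D.trainData ω, D.Z (Fin.last n) ω)) ∂μ ≤ ENNReal.ofReal α := by
    refine le_trans (le_of_eq ?_) (D.sampleErrorLaw_uncovered_le μ hexch hα₀)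
    have hFm : Measurable fun q : (Fin (n + 1) → 𝒳 × ℝ × ℝ × 𝒵 × Fin 2) × (D.J₂ → ℝ) =>
        ∫⁻ e, G (q.1, q.2, e) ∂(D.vecErrorLaw μ (Fin.last n) q.1) :=
      measurable_lintegral_kernel_comp _ measurable_fst (by fun_prop)
    have hr : Measurable fun e : Fin (n + 1) → ℝ =>
      (fun i : D.J₂ => e i.1.castSucc, e (Fin.last n)) := by fun_prop
    refine (h.lintegral_calErrors hFm).trans ?_
    have hI : Measurable fun v : Fin (n + 1) → 𝒳 × ℝ × ℝ × 𝒵 × Fin 2 =>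
        ∫⁻ e : Fin (n + 1) → ℝ, G (v, (fun i : D.J₂ => e i.1.castSucc), e (Fin.last n))
          ∂(piKernel (D.vecErrorLaw μ) v) :=
      measurable_lintegral_kernel_comp _ measurable_id (by fun_prop)
    rw [lintegral_map hI D.measurable_samples]
    refine lintegral_congr fun ω => ?_
    have h2 : (piKernel (D.vecErrorLaw μ) (fun j => D.sample j ω)).map
        (fun e => (fun i : D.J₂ => e i.1.castSucc, e (Fin.last n)))
        = (Measure.pi fun i : D.J₂ => D.errorLaw μ (D.trainData ω, D.Z i.1.castSucc ω)).prod
          (D.vecErrorLaw μ (Fin.last n) fun j => D.sample j ω) :=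
      D.pi_map_calibration_test _
    have h3 := lintegral_map (μ := piKernel (D.vecErrorLaw μ) (fun j => D.sample j ω))
      (f := fun q : (D.J₂ → ℝ) × ℝ => G ((fun j => D.sample j ω), q)) (by fun_prop) hr
    rw [← h3, h2, lintegral_prod _ (by fun_prop)]
  -- Coverage and miss have complementary indicators; stating this as a sum avoids subtraction in
  -- `ENNReal`.
  have hsum : ∀ ω, ∫⁻ e, {e | D.Covers α (D.calInfo ω).2
        (D.impScore (D.trainData ω) (D.sample (Fin.last n) ω) e)}.indicator (fun _ => 1) e
      ∂(D.errorLaw μ (D.trainData ω, D.Z (Fin.last n) ω))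
      + ∫⁻ e, G ((fun j => D.sample j ω), D.calErrors ω, e)
      ∂(D.errorLaw μ (D.trainData ω, D.Z (Fin.last n) ω)) = 1 := by
    intro ω
    rw [← lintegral_add_right _ (by fun_prop)]
    have h1 : ∀ e : ℝ, {e | D.Covers α (D.calInfo ω).2
        (D.impScore (D.trainData ω) (D.sample (Fin.last n) ω) e)}.indicator (fun _ => (1 : ENNReal)) e
        + G ((fun j => D.sample j ω), D.calErrors ω, e) = 1 := by
      intro e
      by_cases hc : D.Covers α (D.calInfo ω).2
        (D.impScore (D.trainData ω) (D.sample (Fin.last n) ω) e)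
      · have : ((fun j => D.sample j ω), D.calErrors ω, e) ∉ D.uncovered α := fun hn => hn hc
        rw [hG, Set.indicator_of_notMem this, Set.indicator_of_mem (by exact hc), add_zero]
      · have : ((fun j => D.sample j ω), D.calErrors ω, e) ∈ D.uncovered α := hc
        rw [hG, Set.indicator_of_mem this, Set.indicator_of_notMem (by exact hc), zero_add]
    rw [lintegral_congr h1]
    simp
  have hm : Measurable fun ω => ∫⁻ e, G ((fun j => D.sample j ω), D.calErrors ω, e)
      ∂(D.errorLaw μ (D.trainData ω, D.Z (Fin.last n) ω)) :=
    measurable_lintegral_kernel_comp _ (D.measurable_trainData.prodMk (D.measurable_Z _))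
      (hGm.comp ((D.measurable_samples.comp measurable_fst).prodMk
        ((D.measurable_calErrors.comp measurable_fst).prodMk measurable_snd)))
  calc (1 : ENNReal) = ∫⁻ _ω, 1 ∂μ := by simp
    _ = _ := lintegral_congr fun ω => (hsum ω).symm
    _ = _ := lintegral_add_right _ hm
    _ ≤ _ := by gcongr

end UIAssumptionsWith

end Experiment

end TriplyRobust

/-! ### Noise, residual and error laws of the test point -/

namespace TriplyRobust

namespace Experiment

section Laws

variable {Ω 𝒳 𝒵 𝓕 : Type*} [MeasurableSpace Ω] [MeasurableSpace 𝒳] [MeasurableSpace 𝒵] {n : ℕ}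
  (D : Experiment Ω 𝒳 𝒵 𝓕 n)

/-- The noise `Y - g*(X, Z)` of the test point. -/
def noise (gstar : 𝒳 → 𝒵 → ℝ) (ω : Ω) : ℝ :=
  D.Y (Fin.last n) ω - gstar (D.X (Fin.last n) ω) (D.Z (Fin.last n) ω)

/-- The residual `ĝ(X, Z) - g*(X, Z)` of the test point. -/
def resid (gstar : 𝒳 → 𝒵 → ℝ) (ω : Ω) : ℝ :=
  D.ghat (D.trainData ω) (D.X (Fin.last n) ω) (D.Z (Fin.last n) ω)
    - gstar (D.X (Fin.last n) ω) (D.Z (Fin.last n) ω)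

/-- The conditional law of the noise given the privileged information. -/
def noiseLaw (μ : Measure Ω) [IsFiniteMeasure μ] (gstar : 𝒳 → 𝒵 → ℝ) : Kernel 𝒵 ℝ :=
  condDistrib (D.noise gstar) (D.Z (Fin.last n)) μ

/-- The conditional law of the residual given the privileged information and the training data. -/
def residLaw (μ : Measure Ω) [IsFiniteMeasure μ] (gstar : 𝒳 → 𝒵 → ℝ) :
    Kernel (𝒵 × D.TrainSpace) ℝ :=
  condDistrib (D.resid gstar) (fun ω => (D.Z (Fin.last n) ω, D.trainData ω)) μ

instance (μ : Measure Ω) [IsFiniteMeasure μ] (gstar : 𝒳 → 𝒵 → ℝ) :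
    IsMarkovKernel (D.noiseLaw μ gstar) := by
  unfold noiseLaw
  infer_instance

instance (μ : Measure Ω) [IsFiniteMeasure μ] (gstar : 𝒳 → 𝒵 → ℝ) :
    IsMarkovKernel (D.residLaw μ gstar) := by
  unfold residLaw
  infer_instance

/-- The conditional probability that a label is corrupted, given the privileged information. -/
def corruptProb (μ : Measure Ω) [IsFiniteMeasure μ] (z : 𝒵) : ENNReal :=
  condDistrib (D.M (Fin.last n)) (D.Z (Fin.last n)) μ z {0}ᶜ

lemma measurable_corruptProb (μ : Measure Ω) [IsFiniteMeasure μ] : Measurable (D.corruptProb μ) :=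
  Kernel.measurable_coe _ (measurableSet_singleton 0).compl

/-- The conditional probability, given the privileged information `z`, that the noise puts the label
into the prediction set after a shift by `d`. -/
def shiftMass (μ : Measure Ω) [IsFiniteMeasure μ] (α : ℝ) (gstar : 𝒳 → 𝒵 → ℝ) (c : D.CalSpace)
    (p : 𝒳 × 𝒵) (d : ℝ) : ENNReal :=
  ∫⁻ v, D.uiInd α c p.1 (gstar p.1 p.2 + v + d) ∂(D.noiseLaw μ gstar p.2)

lemma measurable_shiftMass (μ : Measure Ω) [IsFiniteMeasure μ] (α : ℝ) {gstar : 𝒳 → 𝒵 → ℝ}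
    (hg : Measurable (Function.uncurry gstar)) :
    Measurable fun q : (D.CalSpace × (𝒳 × 𝒵)) × ℝ =>
      D.shiftMass μ α gstar q.1.1 q.1.2 q.2 := by
  refine measurable_lintegral_kernel_comp (D.noiseLaw μ gstar)
    (φ := fun q : (D.CalSpace × (𝒳 × 𝒵)) × ℝ => q.1.2.2) (by fun_prop) ?_
  have h1 : Measurable fun r : ((D.CalSpace × (𝒳 × 𝒵)) × ℝ) × ℝ => gstar r.1.1.2.1 r.1.1.2.2 :=
    hg.comp (by fun_prop : Measurable fun r : ((D.CalSpace × (𝒳 × 𝒵)) × ℝ) × ℝ => r.1.1.2)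
  exact D.measurable_uiInd α (by fun_prop) (by fun_prop) (by fun_prop)

end Laws

variable {Ω 𝒳 𝒵 𝓕 : Type*} [MeasurableSpace Ω] [StandardBorelSpace Ω] [MeasurableSpace 𝒳]
  [MeasurableSpace 𝒵] {n : ℕ} {D : Experiment Ω 𝒳 𝒵 𝓕 n} {μ : Measure Ω} [IsProbabilityMeasure μ]
  {α : ℝ} {gstar : 𝒳 → 𝒵 → ℝ} {a b : Ω → 𝒳 → EReal} {f : 𝒳 × 𝒵 → ℝ → ENNReal}

namespace UIAssumptionsWith

lemma measurable_gstar_test (h : D.UIAssumptionsWith μ α gstar a b f) :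
    Measurable fun ω => gstar (D.X (Fin.last n) ω) (D.Z (Fin.last n) ω) :=
  h.measurable_gstar.comp ((D.measurable_X _).prodMk (D.measurable_Z _))

lemma measurable_noise (h : D.UIAssumptionsWith μ α gstar a b f) : Measurable (D.noise gstar) :=
  (D.measurable_Y _).sub h.measurable_gstar_test

lemma measurable_resid (h : D.UIAssumptionsWith μ α gstar a b f) : Measurable (D.resid gstar) :=
  (D.measurable_ghat.comp (D.measurable_trainData.prodMk
    ((D.measurable_X _).prodMk (D.measurable_Z _)))).sub h.measurable_gstar_test

/-- Given the privileged information, the noise is independent of the covariates, of the training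
data and of the imputed scores. -/
lemma lintegral_noise (h : D.UIAssumptionsWith μ α gstar a b f)
    {F : ((𝒵 × 𝒳) × D.CalSpace) × ℝ → ENNReal} (hF : Measurable F) :
    ∫⁻ ω, F (((D.Z (Fin.last n) ω, D.X (Fin.last n) ω), D.calInfo ω), D.noise gstar ω) ∂μ
      = ∫⁻ ω, ∫⁻ v, F (((D.Z (Fin.last n) ω, D.X (Fin.last n) ω), D.calInfo ω), v)
        ∂(D.noiseLaw μ gstar (D.Z (Fin.last n) ω)) ∂μ := by
  have hZ := D.measurable_Z (Fin.last n)
  have hX := D.measurable_X (Fin.last n)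
  -- The assumption on the noise removes `X` from the conditioning; `calInfo` can be added because
  -- it is independent of the whole test point.
  have h1 := map_eq_compProd_of_condIndepFun hZ hX h.measurable_noise h.noise.symm
  have h2 : Measurable fun s : 𝒳 × ℝ × ℝ × 𝒵 × Fin 2 =>
      ((s.2.2.2.1, s.1), s.2.1 - gstar s.1 s.2.2.2.1) := by
    have : Measurable fun s : 𝒳 × ℝ × ℝ × 𝒵 × Fin 2 => gstar s.1 s.2.2.2.1 :=
      h.measurable_gstar.comp (by fun_prop :
        Measurable fun s : 𝒳 × ℝ × ℝ × 𝒵 × Fin 2 => (s.1, s.2.2.2.1))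
    exact Measurable.prodMk (by fun_prop)
      ((by fun_prop : Measurable fun s : 𝒳 × ℝ × ℝ × 𝒵 × Fin 2 => s.2.1).sub this)
  exact lintegral_of_indepFun_of_map_eq_compProd (hZ.prodMk hX) h.measurable_noise
    D.measurable_calInfo h1 (h.indepFun_calInfo.comp measurable_id h2) hF

/-- Given the privileged information, the corruption indicator is independent of the covariates, the
label, the training data and the imputed scores. -/
lemma lintegral_indicator_corrupt (h : D.UIAssumptionsWith μ α gstar a b f)
    {F : (𝒵 × (𝒳 × ℝ)) × D.CalSpace → ENNReal} (hF : Measurable F) :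
    ∫⁻ ω, ({0}ᶜ : Set (Fin 2)).indicator (fun _ => 1) (D.M (Fin.last n) ω)
        * F ((D.Z (Fin.last n) ω, (D.X (Fin.last n) ω, D.Y (Fin.last n) ω)), D.calInfo ω) ∂μ
      = ∫⁻ ω, D.corruptProb μ (D.Z (Fin.last n) ω)
        * F ((D.Z (Fin.last n) ω, (D.X (Fin.last n) ω, D.Y (Fin.last n) ω)), D.calInfo ω) ∂μ := by
  have hZ := D.measurable_Z (Fin.last n)
  have hXY := (D.measurable_X (Fin.last n)).prodMk (D.measurable_Y (Fin.last n))
  have hM := D.measurable_M (Fin.last n)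
  have h1 := map_eq_compProd_of_condIndepFun hZ hXY hM h.condIndep
  have hi : Measurable (({0}ᶜ : Set (Fin 2)).indicator fun _ => (1 : ENNReal)) :=
    measurable_const.indicator (measurableSet_singleton 0).compl
  have h2 : Measurable fun s : 𝒳 × ℝ × ℝ × 𝒵 × Fin 2 =>
      ((s.2.2.2.1, (s.1, s.2.1)), s.2.2.2.2) := by fun_prop
  have key := lintegral_of_indepFun_of_map_eq_compProd (hZ.prodMk hXY) hM
    D.measurable_calInfo h1 (h.indepFun_calInfo.comp measurable_id h2)
    (F := fun q => ({0}ᶜ : Set (Fin 2)).indicator (fun _ => 1) q.2 * F q.1) (by fun_prop)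
  refine key.trans (lintegral_congr fun ω => ?_)
  dsimp only
  rw [lintegral_mul_const _ hi, corruptProb, Kernel.prodMkRight_apply,
    ← lintegral_indicator_one (measurableSet_singleton 0).compl]
  rfl

/-- Given the privileged information and the training data, the residual is independent of `g*` and
of the endpoints of the prediction interval. -/
lemma lintegral_resid (h : D.UIAssumptionsWith μ α gstar a b f)
    {F : ((𝒵 × D.TrainSpace) × (ℝ × EReal × EReal)) × ℝ → ENNReal} (hF : Measurable F) :
    ∫⁻ ω, F (((D.Z (Fin.last n) ω, D.trainData ω),
        (gstar (D.X (Fin.last n) ω) (D.Z (Fin.last n) ω),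
          a ω (D.X (Fin.last n) ω), b ω (D.X (Fin.last n) ω))), D.resid gstar ω) ∂μ
      = ∫⁻ ω, ∫⁻ r, F (((D.Z (Fin.last n) ω, D.trainData ω),
        (gstar (D.X (Fin.last n) ω) (D.Z (Fin.last n) ω),
          a ω (D.X (Fin.last n) ω), b ω (D.X (Fin.last n) ω))), r)
        ∂(D.residLaw μ gstar (D.Z (Fin.last n) ω, D.trainData ω)) ∂μ := by
  have hW := (D.measurable_Z (Fin.last n)).prodMk D.measurable_trainData
  have hg := h.measurable_gstar_test.prodMk (h.measurable_a.prodMk h.measurable_b)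
  exact lintegral_of_map_eq_compProd (hW.prodMk hg) h.measurable_resid
    (map_eq_compProd_of_condIndepFun hW hg h.measurable_resid h.residual.symm) hF

/-- The true error law is the law of the difference of the noise and of an independent residual. -/
lemma errorLaw_ae_eq (h : D.UIAssumptionsWith μ α gstar a b f) :
    ∀ᵐ ω ∂μ, ∀ G : ℝ → ENNReal, Measurable G →
      ∫⁻ e, G e ∂(D.errorLaw μ (D.trainData ω, D.Z (Fin.last n) ω))
        = ∫⁻ r, ∫⁻ v, G (v - r) ∂(D.noiseLaw μ gstar (D.Z (Fin.last n) ω))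
          ∂(D.residLaw μ gstar (D.Z (Fin.last n) ω, D.trainData ω)) := by
  have hZ := D.measurable_Z (Fin.last n)
  have hX := D.measurable_X (Fin.last n)
  have hT := D.measurable_trainData
  -- The candidate law: draw a residual and a noise independently and subtract.
  set η : Kernel (D.TrainSpace × 𝒵) ℝ :=
    (((D.residLaw μ gstar).comap Prod.swap measurable_swap) ×ₖ
      ((D.noiseLaw μ gstar).comap Prod.snd measurable_snd)).map (fun p => p.2 - p.1) with hη
  have hsub : Measurable fun p : ℝ × ℝ => p.2 - p.1 := by fun_prop
  have : IsMarkovKernel η := Kernel.IsMarkovKernel.map _ hsub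
  have hηi : ∀ p (G : ℝ → ENNReal), Measurable G → ∫⁻ e, G e ∂(η p)
      = ∫⁻ r, ∫⁻ v, G (v - r) ∂(D.noiseLaw μ gstar p.2) ∂(D.residLaw μ gstar (p.2, p.1)) := by
    intro p G hG
    rw [hη, Kernel.lintegral_map _ hsub _ hG, Kernel.lintegral_prod _ _ _ (by fun_prop)]
    rfl
  have hgh : Measurable fun ω => D.ghat (D.trainData ω) (D.X (Fin.last n) ω) (D.Z (Fin.last n) ω) :=
    D.measurable_ghat.comp (hT.prodMk (hX.prodMk hZ))
  have hE : Measurable fun ω => D.Y (Fin.last n) ω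
      - D.ghat (D.trainData ω) (D.X (Fin.last n) ω) (D.Z (Fin.last n) ω) :=
    (D.measurable_Y _).sub hgh
  have key : D.errorLaw μ =ᵐ[μ.map fun ω => (D.trainData ω, D.Z (Fin.last n) ω)] η := by
    refine condDistrib_ae_eq_of_measure_eq_compProd _ hE.aemeasurable
      (map_eq_compProd_of_lintegral (hT.prodMk hZ) hE fun F hF => ?_)
    have hr : Measurable fun q : (𝒵 × 𝒳) × D.CalSpace =>
        D.ghat q.2.1 q.1.2 q.1.1 - gstar q.1.2 q.1.1 := by
      have h1 : Measurable fun q : (𝒵 × 𝒳) × D.CalSpace => D.ghat q.2.1 q.1.2 q.1.1 :=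
        D.measurable_ghat.comp (by fun_prop :
          Measurable fun q : (𝒵 × 𝒳) × D.CalSpace => (q.2.1, q.1.2, q.1.1))
      have h2 : Measurable fun q : (𝒵 × 𝒳) × D.CalSpace => gstar q.1.2 q.1.1 :=
        h.measurable_gstar.comp (by fun_prop :
          Measurable fun q : (𝒵 × 𝒳) × D.CalSpace => (q.1.2, q.1.1))
      exact h1.sub h2
    -- The residual is a function of `X`, `Z` and the training data, so the noise can be integrated
    -- out with the residual held fixed; the residual is integrated next.
    have e1 := h.lintegral_noise (F := fun q => F ((q.1.2.1, q.1.1.1),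
      q.2 - (D.ghat q.1.2.1 q.1.1.2 q.1.1.1 - gstar q.1.1.2 q.1.1.1)))
      (hF.comp (Measurable.prodMk (by fun_prop) (measurable_snd.sub (hr.comp measurable_fst))))
    have hG : Measurable fun q : (𝒵 × D.TrainSpace) × ℝ =>
        ∫⁻ v, F ((q.1.2, q.1.1), v - q.2) ∂(D.noiseLaw μ gstar q.1.1) :=
      measurable_lintegral_kernel_comp _ (by fun_prop) (by fun_prop)
    have e2 := lintegral_condDistrib μ (hZ.prodMk hT) h.measurable_resid hG
    calc ∫⁻ ω, F ((D.trainData ω, D.Z (Fin.last n) ω), D.Y (Fin.last n) ω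
          - D.ghat (D.trainData ω) (D.X (Fin.last n) ω) (D.Z (Fin.last n) ω)) ∂μ
        = ∫⁻ ω, F ((D.trainData ω, D.Z (Fin.last n) ω), D.noise gstar ω - D.resid gstar ω) ∂μ := by
          refine lintegral_congr fun ω => ?_
          congr 2
          simp only [Experiment.noise, resid]
          ring
      _ = ∫⁻ ω, ∫⁻ v, F ((D.trainData ω, D.Z (Fin.last n) ω), v - D.resid gstar ω)
          ∂(D.noiseLaw μ gstar (D.Z (Fin.last n) ω)) ∂μ := e1
      _ = _ := e2
      _ = _ := lintegral_congr fun ω => (hηi (D.trainData ω, D.Z (Fin.last n) ω)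
          (fun e => F ((D.trainData ω, D.Z (Fin.last n) ω), e)) (by fun_prop)).symm
  filter_upwards [ae_of_ae_map (hT.prodMk hZ).aemeasurable key] with ω hω G hG
  rw [hω, hηi _ G hG]

/-- The conditional law of the label given covariates and privileged information is the noise law
shifted by `g*`. -/
lemma noiseLaw_shift_ae_eq (h : D.UIAssumptionsWith μ α gstar a b f) :
    ∀ᵐ p ∂(μ.map fun ω => (D.X (Fin.last n) ω, D.Z (Fin.last n) ω)),
      (D.noiseLaw μ gstar p.2).map (fun v => gstar p.1 p.2 + v) = volume.withDensity (f p) := by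
  have hZ := D.measurable_Z (Fin.last n)
  have hX := D.measurable_X (Fin.last n)
  have hadd : Measurable fun q : (𝒳 × 𝒵) × ℝ => gstar q.1.1 q.1.2 + q.2 :=
    (h.measurable_gstar.comp measurable_fst).add measurable_snd
  -- The identity factor carries `(x, z)` along, so that the shift `g* (x, z)` is available after
  -- the noise is drawn.
  set η : Kernel (𝒳 × 𝒵) ℝ :=
    (Kernel.id ×ₖ ((D.noiseLaw μ gstar).comap Prod.snd measurable_snd)).map
      (fun q => gstar q.1.1 q.1.2 + q.2) with hη
  have : IsMarkovKernel η := Kernel.IsMarkovKernel.map _ hadd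
  have hηi : ∀ p (G : ℝ → ENNReal), Measurable G → ∫⁻ e, G e ∂(η p)
      = ∫⁻ v, G (gstar p.1 p.2 + v) ∂(D.noiseLaw μ gstar p.2) := by
    intro p G hG
    have hG' : Measurable fun q : (𝒳 × 𝒵) × ℝ => G (gstar q.1.1 q.1.2 + q.2) := hG.comp hadd
    rw [hη, Kernel.lintegral_map _ hadd _ hG, Kernel.lintegral_prod _ _ _ hG',
      Kernel.id_apply, lintegral_dirac' _ hG'.lintegral_prod_right']
    rfl
  have key : condDistrib (D.Y (Fin.last n)) (fun ω => (D.X (Fin.last n) ω, D.Z (Fin.last n) ω)) μ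
      =ᵐ[μ.map fun ω => (D.X (Fin.last n) ω, D.Z (Fin.last n) ω)] η := by
    refine condDistrib_ae_eq_of_measure_eq_compProd _ (D.measurable_Y _).aemeasurable
      (map_eq_compProd_of_lintegral (hX.prodMk hZ) (D.measurable_Y _) fun F hF => ?_)
    have hg : Measurable fun q : ((𝒵 × 𝒳) × D.CalSpace) × ℝ => gstar q.1.1.2 q.1.1.1 :=
      h.measurable_gstar.comp (by fun_prop :
        Measurable fun q : ((𝒵 × 𝒳) × D.CalSpace) × ℝ => (q.1.1.2, q.1.1.1))
    have e1 := h.lintegral_noise (F := fun q => F ((q.1.1.2, q.1.1.1),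
      gstar q.1.1.2 q.1.1.1 + q.2))
      (hF.comp (Measurable.prodMk (by fun_prop) (hg.add measurable_snd)))
    calc ∫⁻ ω, F ((D.X (Fin.last n) ω, D.Z (Fin.last n) ω), D.Y (Fin.last n) ω) ∂μ
        = ∫⁻ ω, F ((D.X (Fin.last n) ω, D.Z (Fin.last n) ω),
          gstar (D.X (Fin.last n) ω) (D.Z (Fin.last n) ω) + D.noise gstar ω) ∂μ := by
          refine lintegral_congr fun ω => ?_
          rw [Experiment.noise, add_sub_cancel]
      _ = _ := e1
      _ = _ := lintegral_congr fun ω => (hηi (D.X (Fin.last n) ω, D.Z (Fin.last n) ω)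
          (fun e => F ((D.X (Fin.last n) ω, D.Z (Fin.last n) ω), e)) (by fun_prop)).symm
  filter_upwards [key, h.density] with p hp1 hp2
  rw [← hp2, hp1]
  refine Measure.ext_of_lintegral _ fun G hG => ?_
  rw [hηi p G hG, lintegral_map hG (by fun_prop)]

/-- Shifting the label by `d` to the left or to the right, with equal chances, does not increase
its chance to be in the prediction interval. -/
lemma shiftMass_add_le (h : D.UIAssumptionsWith μ α gstar a b f) (hα : α < 1) :
    ∀ᵐ ω ∂μ, ∀ᵐ p ∂(μ.map fun ω => (D.X (Fin.last n) ω, D.Z (Fin.last n) ω)), ∀ d : ℝ,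
      D.shiftMass μ α gstar (D.calInfo ω) p d + D.shiftMass μ α gstar (D.calInfo ω) p (-d)
        ≤ 2 * D.shiftMass μ α gstar (D.calInfo ω) p 0 := by
  filter_upwards [h.interval, h.peaked] with ω hω hpk
  filter_upwards [hpk, h.noiseLaw_shift_ae_eq] with p hp hdens d
  set ν := (D.noiseLaw μ gstar p.2).map (fun v => gstar p.1 p.2 + v) with hν
  have hsm : Measurable fun v : ℝ => gstar p.1 p.2 + v := by fun_prop
  have : IsProbabilityMeasure ν := Measure.isProbabilityMeasure_map hsm.aemeasurable
  -- Replaces the prediction set by its interval form, so that the shift inequality applies to the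
  -- conditional law of the label, which has the density `f p`.
  have hrep : ∀ d : ℝ, D.shiftMass μ α gstar (D.calInfo ω) p d
      = ν {y | a ω p.1 ≤ ((y + d : ℝ) : EReal) ∧ ((y + d : ℝ) : EReal) ≤ b ω p.1} := by
    intro d
    have hm : MeasurableSet {y : ℝ | a ω p.1 ≤ ((y + d : ℝ) : EReal)
        ∧ ((y + d : ℝ) : EReal) ≤ b ω p.1} := by
      have hc : Measurable fun y : ℝ => ((y + d : ℝ) : EReal) :=
        measurable_coe_real_ereal.comp (by fun_prop)
      exact (measurableSet_le measurable_const hc).inter (measurableSet_le hc measurable_const)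
    rw [← lintegral_indicator_one hm, hν, lintegral_map (measurable_one.indicator hm) hsm]
    refine lintegral_congr fun v => ?_
    rw [D.uiInd_eq_indicator hα, hω p.1]
    rfl
  rw [hrep, hrep, hrep]
  have := hp.measure_shift_le (h.measurable_density p) hdens d
  simpa only [add_zero, sub_eq_add_neg] using this

end UIAssumptionsWith

end Experiment

end TriplyRobust

/-! ### Coverage of UI -/

namespace TriplyRobust

namespace Experiment

variable {Ω 𝒳 𝒵 𝓕 : Type*} [MeasurableSpace Ω] [StandardBorelSpace Ω] [MeasurableSpace 𝒳]
  [MeasurableSpace 𝒵] {n : ℕ} {D : Experiment Ω 𝒳 𝒵 𝓕 n} {μ : Measure Ω} [IsProbabilityMeasure μ]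
  {α : ℝ} {gstar : 𝒳 → 𝒵 → ℝ} {a b : Ω → 𝒳 → EReal} {f : 𝒳 × 𝒵 → ℝ → ENNReal}

namespace UIAssumptionsWith

/-- The mass that the true error law gives to the prediction set, for an imputed test label. -/
lemma lintegral_imputed_eq (h : D.UIAssumptionsWith μ α gstar a b f) (hα : α < 1) :
    ∫⁻ ω, D.corruptProb μ (D.Z (Fin.last n) ω) * (∫⁻ e, D.uiInd α (D.calInfo ω)
        (D.X (Fin.last n) ω) (D.ghat (D.trainData ω) (D.X (Fin.last n) ω) (D.Z (Fin.last n) ω) + e)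
          ∂(D.errorLaw μ (D.trainData ω, D.Z (Fin.last n) ω))) ∂μ
      = ∫⁻ ω, D.corruptProb μ (D.Z (Fin.last n) ω) * (∫⁻ r, ∫⁻ r', D.shiftMass μ α gstar
          (D.calInfo ω) (D.X (Fin.last n) ω, D.Z (Fin.last n) ω) (r - r')
          ∂(D.residLaw μ gstar (D.Z (Fin.last n) ω, D.trainData ω))
          ∂(D.residLaw μ gstar (D.Z (Fin.last n) ω, D.trainData ω))) ∂μ := by
  set I : Set (EReal × EReal × ℝ) := {q | q.1 ≤ (q.2.2 : EReal) ∧ (q.2.2 : EReal) ≤ q.2.1} with hI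
  have hIm : MeasurableSet I := by
    have hc : Measurable fun q : EReal × EReal × ℝ => (q.2.2 : EReal) :=
      measurable_coe_real_ereal.comp (by fun_prop)
    exact (measurableSet_le (by fun_prop) hc).inter (measurableSet_le hc (by fun_prop))
  set χ : EReal × EReal × ℝ → ENNReal := I.indicator fun _ => 1 with hχ
  have hχm : Measurable χ := measurable_const.indicator hIm
  -- The residual is independent of `g*`, `a` and `b` only, so at the test covariate the prediction
  -- set must be expressed through its endpoints.
  have hui : ∀ᵐ ω ∂μ, ∀ y, D.uiInd α (D.calInfo ω) (D.X (Fin.last n) ω) y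
      = χ (a ω (D.X (Fin.last n) ω), b ω (D.X (Fin.last n) ω), y) := by
    filter_upwards [h.interval] with ω hω y
    rw [D.uiInd_eq_indicator hα, hω]
    rfl
  set F : ((𝒵 × D.TrainSpace) × (ℝ × EReal × EReal)) × ℝ → ENNReal := fun q =>
    D.corruptProb μ q.1.1.1 * ∫⁻ r', ∫⁻ v, χ (q.1.2.2.1, q.1.2.2.2, q.1.2.1 + q.2 + (v - r'))
      ∂(D.noiseLaw μ gstar q.1.1.1) ∂(D.residLaw μ gstar q.1.1) with hF
  have hin : Measurable fun q : ((𝒵 × D.TrainSpace) × (ℝ × EReal × EReal)) × ℝ =>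
      ∫⁻ r', ∫⁻ v, χ (q.1.2.2.1, q.1.2.2.2, q.1.2.1 + q.2 + (v - r'))
      ∂(D.noiseLaw μ gstar q.1.1.1) ∂(D.residLaw μ gstar q.1.1) := by
    refine measurable_lintegral_kernel_comp (D.residLaw μ gstar)
      (φ := fun q : ((𝒵 × D.TrainSpace) × (ℝ × EReal × EReal)) × ℝ => q.1.1) (by fun_prop) ?_
    refine measurable_lintegral_kernel_comp (D.noiseLaw μ gstar)
      (φ := fun q : (((𝒵 × D.TrainSpace) × (ℝ × EReal × EReal)) × ℝ) × ℝ => q.1.1.1.1)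
      (by fun_prop) ?_
    fun_prop
  have hπ := D.measurable_corruptProb μ
  have hFm : Measurable F := by fun_prop
  have e1 : ∫⁻ ω, D.corruptProb μ (D.Z (Fin.last n) ω) * (∫⁻ e, D.uiInd α (D.calInfo ω)
        (D.X (Fin.last n) ω) (D.ghat (D.trainData ω) (D.X (Fin.last n) ω) (D.Z (Fin.last n) ω) + e)
          ∂(D.errorLaw μ (D.trainData ω, D.Z (Fin.last n) ω))) ∂μ
      = ∫⁻ ω, F (((D.Z (Fin.last n) ω, D.trainData ω),
        (gstar (D.X (Fin.last n) ω) (D.Z (Fin.last n) ω),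
          a ω (D.X (Fin.last n) ω), b ω (D.X (Fin.last n) ω))), D.resid gstar ω) ∂μ := by
    -- Substituting the error law, the imputed label becomes `g* + R + (v - r')`, with `R` the
    -- actual residual and `v`, `r'` fresh draws.
    refine lintegral_congr_ae ?_
    filter_upwards [hui, h.errorLaw_ae_eq] with ω h1 h2
    simp only [h1, hF]
    congr 1
    rw [h2 _ (by fun_prop)]
    refine lintegral_congr fun r' => lintegral_congr fun v => ?_
    congr 3
    simp only [resid]
    ring
  -- Conditional independence replaces `R` by a draw `r` from the same law as `r'`, independent of
  -- it.
  rw [e1, h.lintegral_resid hFm]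
  refine lintegral_congr_ae ?_
  filter_upwards [hui] with ω h1
  have hin' : Measurable fun r : ℝ => ∫⁻ r', ∫⁻ v, χ (a ω (D.X (Fin.last n) ω),
      b ω (D.X (Fin.last n) ω), gstar (D.X (Fin.last n) ω) (D.Z (Fin.last n) ω) + r + (v - r'))
      ∂(D.noiseLaw μ gstar (D.Z (Fin.last n) ω))
      ∂(D.residLaw μ gstar (D.Z (Fin.last n) ω, D.trainData ω)) :=
    hin.comp (measurable_prodMk_left (x := ((D.Z (Fin.last n) ω, D.trainData ω),
      (gstar (D.X (Fin.last n) ω) (D.Z (Fin.last n) ω), a ω (D.X (Fin.last n) ω),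
        b ω (D.X (Fin.last n) ω)))))
  simp only [hF]
  rw [lintegral_const_mul _ hin']
  congr 1
  refine lintegral_congr fun r => lintegral_congr fun r' => ?_
  rw [shiftMass]
  refine lintegral_congr fun v => ?_
  rw [h1]
  congr 3
  ring

/-- Imputing the label of a corrupted test point does not increase its chance to be covered. -/
lemma lintegral_imputed_le (h : D.UIAssumptionsWith μ α gstar a b f) (hα : α < 1) :
    ∫⁻ ω, D.corruptProb μ (D.Z (Fin.last n) ω) * (∫⁻ e, D.uiInd α (D.calInfo ω)
        (D.X (Fin.last n) ω) (D.ghat (D.trainData ω) (D.X (Fin.last n) ω) (D.Z (Fin.last n) ω) + e)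
          ∂(D.errorLaw μ (D.trainData ω, D.Z (Fin.last n) ω))) ∂μ
      ≤ ∫⁻ ω, D.corruptProb μ (D.Z (Fin.last n) ω)
        * D.uiInd α (D.calInfo ω) (D.X (Fin.last n) ω) (D.Y (Fin.last n) ω) ∂μ := by
  have hZ := D.measurable_Z (Fin.last n)
  have hX := D.measurable_X (Fin.last n)
  have hπ := D.measurable_corruptProb μ
  have hsm := D.measurable_shiftMass μ α h.measurable_gstar
  have hG : Measurable fun q : D.CalSpace × (𝒳 × 𝒵) => ∫⁻ r, ∫⁻ r', D.shiftMass μ α gstar q.1 q.2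
      (r - r') ∂(D.residLaw μ gstar (q.2.2, q.1.1)) ∂(D.residLaw μ gstar (q.2.2, q.1.1)) := by
    refine measurable_lintegral_kernel_comp (D.residLaw μ gstar)
      (φ := fun q : D.CalSpace × (𝒳 × 𝒵) => (q.2.2, q.1.1)) (by fun_prop) ?_
    refine measurable_lintegral_kernel_comp (D.residLaw μ gstar)
      (φ := fun q : (D.CalSpace × (𝒳 × 𝒵)) × ℝ => (q.1.2.2, q.1.1.1)) (by fun_prop) ?_
    exact hsm.comp (by fun_prop : Measurable fun q : ((D.CalSpace × (𝒳 × 𝒵)) × ℝ) × ℝ =>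
      (q.1.1, q.1.2 - q.2))
  have hH : Measurable fun q : D.CalSpace × (𝒳 × 𝒵) => D.shiftMass μ α gstar q.1 q.2 0 :=
    hsm.comp (by fun_prop : Measurable fun q : D.CalSpace × (𝒳 × 𝒵) => (q, (0 : ℝ)))
  have hXZ : Measurable fun s : 𝒳 × ℝ × ℝ × 𝒵 × Fin 2 => (s.1, s.2.2.2.1) := by fun_prop
  have hind : IndepFun D.calInfo (fun ω => (D.X (Fin.last n) ω, D.Z (Fin.last n) ω)) μ :=
    h.indepFun_calInfo.comp measurable_id hXZ
  have hpi : Measurable fun q : D.CalSpace × (𝒳 × 𝒵) => D.corruptProb μ q.2.2 :=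
    hπ.comp (by fun_prop)
  rw [h.lintegral_imputed_eq hα]
  -- The peakedness holds for almost every prediction set and then almost every `(x, z)`, which
  -- suffices because the two are drawn independently.
  refine (lintegral_mono_of_indepFun D.measurable_calInfo (hX.prodMk hZ) hind
    (hpi.mul hG) (hpi.mul hH) ?_).trans (le_of_eq ?_)
  · filter_upwards [h.shiftMass_add_le hα] with ω hω
    filter_upwards [hω] with p hp
    simp only [Pi.mul_apply]
    gcongr
    set L := D.residLaw μ gstar (p.2, (D.calInfo ω).1) with hL
    set q : ℝ → ENNReal := fun d => D.shiftMass μ α gstar (D.calInfo ω) p d with hq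
    have hqm : Measurable q :=
      hsm.comp (measurable_prodMk_left (x := (D.calInfo ω, p)))
    have hswap : ∫⁻ r, ∫⁻ r', q (r - r') ∂L ∂L = ∫⁻ r, ∫⁻ r', q (r' - r) ∂L ∂L :=
      lintegral_lintegral_swap (by fun_prop)
    -- The law of `r - r'` is symmetric by Tonelli, so each shift can be paired with its opposite.
    have htwo : 2 * ∫⁻ r, ∫⁻ r', q (r - r') ∂L ∂L ≤ 2 * q 0 := by
      calc 2 * ∫⁻ r, ∫⁻ r', q (r - r') ∂L ∂L
          = ∫⁻ r, ∫⁻ r', q (r - r') ∂L ∂L + ∫⁻ r, ∫⁻ r', q (r' - r) ∂L ∂L := by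
            rw [two_mul, ← hswap]
        _ = ∫⁻ r, ∫⁻ r', (q (r - r') + q (r' - r)) ∂L ∂L := by
            rw [← lintegral_add_left]
            · refine lintegral_congr fun r => ?_
              rw [lintegral_add_left (by fun_prop)]
            · exact Measurable.lintegral_prod_right (f := fun r r' => q (r - r')) (by fun_prop)
        _ ≤ ∫⁻ _r, ∫⁻ _r', 2 * q 0 ∂L ∂L := by
            refine lintegral_mono fun r => lintegral_mono fun r' => ?_
            have := hp (r - r')
            rwa [neg_sub] at this
        _ = 2 * q 0 := by simp
    exact (ENNReal.mul_le_mul_iff_right (by simp) (by simp)).1 htwo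
  · have hgs : Measurable fun q : ((𝒵 × 𝒳) × D.CalSpace) × ℝ => gstar q.1.1.2 q.1.1.1 :=
      h.measurable_gstar.comp (by fun_prop :
        Measurable fun q : ((𝒵 × 𝒳) × D.CalSpace) × ℝ => (q.1.1.2, q.1.1.1))
    have hu : Measurable fun q : ((𝒵 × 𝒳) × D.CalSpace) × ℝ =>
        D.uiInd α q.1.2 q.1.1.2 (gstar q.1.1.2 q.1.1.1 + q.2 + 0) :=
      D.measurable_uiInd α (by fun_prop) (by fun_prop) ((hgs.add measurable_snd).add measurable_const)
    -- The unshifted case puts the true label back together as `g* + ε`; the `+ 0` matches the shift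
    -- in `shiftMass`.
    have e1 := h.lintegral_noise (F := fun q => D.corruptProb μ q.1.1.1
      * D.uiInd α q.1.2 q.1.1.2 (gstar q.1.1.2 q.1.1.1 + q.2 + 0)) (by fun_prop)
    have e2 : ∀ ω, D.corruptProb μ (D.Z (Fin.last n) ω) * D.uiInd α (D.calInfo ω)
        (D.X (Fin.last n) ω) (D.Y (Fin.last n) ω)
        = D.corruptProb μ (D.Z (Fin.last n) ω) * D.uiInd α (D.calInfo ω)
        (D.X (Fin.last n) ω) (gstar (D.X (Fin.last n) ω) (D.Z (Fin.last n) ω)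
          + D.noise gstar ω + 0) := by
      intro ω
      rw [Experiment.noise, add_sub_cancel, add_zero]
    rw [lintegral_congr e2]
    refine Eq.trans ?_ e1.symm
    refine lintegral_congr fun ω => ?_
    have hu' : Measurable fun v : ℝ => D.uiInd α (D.calInfo ω) (D.X (Fin.last n) ω)
        (gstar (D.X (Fin.last n) ω) (D.Z (Fin.last n) ω) + v + 0) :=
      D.measurable_uiInd α measurable_const measurable_const (by fun_prop)
    dsimp only
    rw [lintegral_const_mul _ hu']
    simp only [Pi.mul_apply, shiftMass]

/-- Compares the coverage of the true label with that of the imputed one: they agree on clean test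
points, and the true label does at least as well on corrupted ones. -/
theorem uiSet_coverage (h : D.UIAssumptionsWith μ α gstar a b f) (hexch : Exchangeable μ D.sample)
    (hα₀ : 0 < α) (hα₁ : α < 1) :
    1 - α ≤ μ.real {ω | D.Y (Fin.last n) ω ∈ D.uiSet α ω (D.X (Fin.last n) ω)} := by
  have hZ := D.measurable_Z (Fin.last n)
  have hX := D.measurable_X (Fin.last n)
  have hY := D.measurable_Y (Fin.last n)
  have hM := D.measurable_M (Fin.last n)
  have hT := D.measurable_trainData
  have hC := D.measurable_calInfo
  set U : Ω → ENNReal := fun ω => D.uiInd α (D.calInfo ω) (D.X (Fin.last n) ω)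
    (D.Y (Fin.last n) ω) with hU
  have hUm : Measurable U := D.measurable_uiInd α hC hX hY
  have hi₀ : Measurable (({0} : Set (Fin 2)).indicator fun _ => (1 : ENNReal)) :=
    measurable_const.indicator (measurableSet_singleton 0)
  set k : (𝒵 × (𝒳 × ℝ)) × D.CalSpace → ENNReal := fun q =>
    ∫⁻ e, D.uiInd α q.2 q.1.2.1 (D.ghat q.2.1 q.1.2.1 q.1.1 + e) ∂(D.errorLaw μ (q.2.1, q.1.1))
    with hk
  have hkm : Measurable k := by
    refine measurable_lintegral_kernel_comp (D.errorLaw μ)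
      (φ := fun q : (𝒵 × (𝒳 × ℝ)) × D.CalSpace => (q.2.1, q.1.1)) (by fun_prop) ?_
    have hg : Measurable fun r : ((𝒵 × (𝒳 × ℝ)) × D.CalSpace) × ℝ =>
        D.ghat r.1.2.1 r.1.1.2.1 r.1.1.1 := D.measurable_ghat.comp (by fun_prop :
      Measurable fun r : ((𝒵 × (𝒳 × ℝ)) × D.CalSpace) × ℝ => (r.1.2.1, r.1.1.2.1, r.1.1.1))
    exact D.measurable_uiInd α (by fun_prop) (by fun_prop) (by fun_prop)
  set W : Ω → (𝒵 × (𝒳 × ℝ)) × D.CalSpace := fun ω =>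
    ((D.Z (Fin.last n) ω, (D.X (Fin.last n) ω, D.Y (Fin.last n) ω)), D.calInfo ω) with hW
  have hsplit : ∀ ω, ∫⁻ e, {e | D.Covers α (D.calInfo ω).2
        (D.impScore (D.trainData ω) (D.sample (Fin.last n) ω) e)}.indicator (fun _ => 1) e
      ∂(D.errorLaw μ (D.trainData ω, D.Z (Fin.last n) ω))
      = ({0} : Set (Fin 2)).indicator (fun _ => 1) (D.M (Fin.last n) ω) * U ω
        + ({0}ᶜ : Set (Fin 2)).indicator (fun _ => 1) (D.M (Fin.last n) ω) * k (W ω) := by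
    intro ω
    by_cases hω : D.M (Fin.last n) ω = 0
    · have h1 : ∀ e, D.impScore (D.trainData ω) (D.sample (Fin.last n) ω) e
          = D.score (D.X (Fin.last n) ω) (D.Y (Fin.last n) ω) (D.fhat (D.trainData ω)) := by
        intro e
        simp only [impScore, sample, hω, if_true, D.Yobs_eq_of_clean _ _ hω]
      have h2 : ∀ e : ℝ, {e | D.Covers α (D.calInfo ω).2
          (D.impScore (D.trainData ω) (D.sample (Fin.last n) ω) e)}.indicator
            (fun _ => (1 : ENNReal)) e = U ω := by
        intro e
        simp only [h1, hU, uiInd]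
        rfl
      rw [lintegral_congr h2]
      simp [hω]
    · have h1 : ∀ e : ℝ, {e | D.Covers α (D.calInfo ω).2
          (D.impScore (D.trainData ω) (D.sample (Fin.last n) ω) e)}.indicator
            (fun _ => (1 : ENNReal)) e = D.uiInd α (D.calInfo ω) (D.X (Fin.last n) ω)
              (D.ghat (D.trainData ω) (D.X (Fin.last n) ω) (D.Z (Fin.last n) ω) + e) := by
        intro e
        simp only [uiInd, impScore, sample, hω, if_false]
        rfl
      rw [lintegral_congr h1]
      simp only [Set.indicator_apply, Set.mem_singleton_iff, Set.mem_compl_iff, hω, if_false,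
        not_false_eq_true, if_true, zero_mul, zero_add, one_mul]
      rfl
  have hmain : ∫⁻ ω, ∫⁻ e, {e | D.Covers α (D.calInfo ω).2
        (D.impScore (D.trainData ω) (D.sample (Fin.last n) ω) e)}.indicator (fun _ => 1) e
      ∂(D.errorLaw μ (D.trainData ω, D.Z (Fin.last n) ω)) ∂μ ≤ ∫⁻ ω, U ω ∂μ := by
    have hu2 : Measurable fun q : (𝒵 × (𝒳 × ℝ)) × D.CalSpace => D.uiInd α q.2 q.1.2.1 q.1.2.2 :=
      D.measurable_uiInd α (by fun_prop) (by fun_prop) (by fun_prop)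
    -- Both integrands depend on the test indicator only through the corruption event, so it can be
    -- traded for its conditional probability given `Z`, under which the comparison is available.
    have hA : ∫⁻ ω, ({0}ᶜ : Set (Fin 2)).indicator (fun _ => 1) (D.M (Fin.last n) ω) * k (W ω) ∂μ
        ≤ ∫⁻ ω, ({0}ᶜ : Set (Fin 2)).indicator (fun _ => 1) (D.M (Fin.last n) ω) * U ω ∂μ := by
      rw [h.lintegral_indicator_corrupt hkm]
      refine (h.lintegral_imputed_le hα₁).trans (le_of_eq ?_)
      exact (h.lintegral_indicator_corrupt hu2).symm
    have hm₀ : Measurable fun ω =>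
        ({0} : Set (Fin 2)).indicator (fun _ => 1) (D.M (Fin.last n) ω) * U ω :=
      (hi₀.comp hM).mul hUm
    rw [lintegral_congr hsplit, lintegral_add_left hm₀]
    refine (add_le_add le_rfl hA).trans (le_of_eq ?_)
    rw [← lintegral_add_left hm₀]
    refine lintegral_congr fun ω => ?_
    by_cases hω : D.M (Fin.last n) ω = 0 <;> simp [hω]
  have hUμ : ∫⁻ ω, U ω ∂μ = μ {ω | D.Y (Fin.last n) ω ∈ D.uiSet α ω (D.X (Fin.last n) ω)} := by
    have hset : MeasurableSet {ω | D.Y (Fin.last n) ω ∈ D.uiSet α ω (D.X (Fin.last n) ω)} := by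
      simp only [D.mem_uiSet_iff hα₁]
      refine D.measurableSet_covers α (measurable_snd.comp hC) ?_
      exact D.measurable_score.comp (hT.prodMk (hX.prodMk hY))
    rw [← lintegral_indicator_one hset]
    refine lintegral_congr fun ω => ?_
    simp only [hU]
    rw [D.uiInd_eq_indicator hα₁]
    rfl
  have hfin := (h.one_le_imputed_coverage hexch hα₀).trans (add_le_add (hmain.trans_eq hUμ) le_rfl)
  have h1 := ENNReal.toReal_mono (ENNReal.add_ne_top.2 ⟨measure_ne_top _ _, ENNReal.ofReal_ne_top⟩)
    hfin
  rw [ENNReal.toReal_add (measure_ne_top _ _) ENNReal.ofReal_ne_top, ENNReal.toReal_one,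
    ENNReal.toReal_ofReal hα₀.le] at h1
  rw [Measure.real]
  linarith

end UIAssumptionsWith

end Experiment

end TriplyRobust

end

theorem theorem5 {Ω 𝒳 𝒵 𝓕 : Type*} [MeasurableSpace Ω] [StandardBorelSpace Ω]
    [MeasurableSpace 𝒳] [MeasurableSpace 𝒵] (μ : Measure Ω) [IsProbabilityMeasure μ] {n : ℕ}
    (D : TriplyRobust.Experiment Ω 𝒳 𝒵 𝓕 n) (α β : ℝ) (hα₀ : 0 < α) (hα₁ : α < 1)
    (hβ₀ : 0 < β) (hβ₁ : β < α)
    (hexch : TriplyRobust.Exchangeable μ D.sample)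
    (hindep : D.CondIndepGivenPI μ)
    (h : D.ScoresExchangeable μ ∨ D.PCPAssumptions μ ∨ D.UIAssumptions μ α) :
    1 - α ≤ μ.real {ω | D.Y (Fin.last n) ω ∈ D.triplySet α β ω (D.X (Fin.last n) ω)} := by
  rcases h with h | h | ⟨gstar, a, b, f, h⟩
  · exact (D.naiveSet_coverage μ hα₀ hα₁ h).trans
      (measureReal_mono fun ω hω => Or.inl (Or.inl hω))
  · exact (D.pcpSet_coverage μ hα₀ hα₁ hβ₀ hβ₁ h).trans
      (measureReal_mono fun ω hω => Or.inl (Or.inr hω))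
  · exact (h.uiSet_coverage hexch hα₀ hα₁).trans (measureReal_mono fun ω hω => Or.inr hω)
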